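/- All graphs are finite, simple and undirected. Two distinct vertices $u,v$ of a graph $G$ are twins if they have the same closed neighbourhood, $N_G(u)\cup\{u\}=N_G(v)\cup\{v\}$; $G$ is twin-free if it has no twins. An interval is a nonempty set of one of the forms $[a,b]$, $(a,b)$, $(a,b]$, $[a,b)$ with $a,b\in\mathbb{R}$; a unit interval is one of these four sets with $b=a+1$. A graph $G$ is an interval graph (respectively, a mixed unit interval graph) if one can assign to each vertex $v$ an interval (respectively, a unit interval) $I(v)$ such that two distinct vertices $u,v$ are adjacent if and only if $I(u)\cap I(v)\neq\emptyset$. For a set $\mathcal{M}$ of graphs, $G$ is $\mathcal{M}$-free if no member of $\mathcal{M}$ is isomorphic to an induced subgraph of $G$. For $k\ge 0$ let $Q_k$ be the graph with vertices $b_0,\dots,b_{k+1},t_0,\dots,t_k$ and the following edges: $b_jb_{j+1}$ for $0\le j\le k$, $t_jb_{j+1}$ for $0\le j\le k$, and $t_jb_j$ for $1\le j\le k$. Define the following graphs. - $K_{2,3}^*$ is obtained from the complete bipartite graph $K_{2,3}$ by joining the two vertices of the part of size two. - $R_k$ ($k\ge 0$) is obtained from $Q_k$ by adding two new vertices, each adjacent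 exactly to $b_{k+1}$; $\mathcal{R}=\{R_k:k\ge 0\}$. - $S_k$ ($k\ge 1$) is obtained from $Q_k$ by adding a new vertex adjacent exactly to $t_{k-1}$, $b_k$ and $t_k$; $\mathcal{S}=\{S_k:k\ge 1\}$. - $S_k'$ ($k\ge 1$) is obtained from $Q_k$ by adding a new vertex adjacent exactly to $b_k$, $b_{k+1}$ and $t_k$; $\mathcal{S}'=\{S_k':k\ge 1\}$. - $T_{i,j}$ ($i\ge j\ge 0$) is obtained from the disjoint union of $Q_i$ and a copy of $Q_j$ with vertices $b'_0,\dots,b'_{j+1},t'_0,\dots,t'_j$ by adding the three edges $b_{i+1}b'_{j+1}$, $b_{i+1}t'_j$ and $t_ib'_{j+1}$; $\mathcal{T}=\{T_{i,j}:i\ge j\ge 0\}$. **Theorem.** A twin-free graph $G$ is a mixed unit interval graph if and only if $G$ is an interval graph and $G$ is $\{K_{2,3}^*\}\cup\mathcal{R}\cup\mathcal{S}\cup\mathcal{S}'\cup\mathcal{T}$-free. -/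

import Mathlib

namespace MixedUnitInterval

universe u

/-! ### Twins and forbidden induced subgraphs -/

/-- The closed neighbourhood `N_G[v] = N_G(v) ∪ {v}`. -/
def closedNbhd {V : Type u} (G : SimpleGraph V) (v : V) : Set V :=
  G.neighborSet v ∪ {v}

/-- `G` has no two distinct vertices with the same closed neighbourhood. -/
def TwinFree {V : Type u} (G : SimpleGraph V) : Prop :=
  ∀ x y : V, x ≠ y → closedNbhd G x ≠ closedNbhd G y

/-- A set of graphs (each on a vertex type of its own). -/
abbrev GraphFamily : Type 1 := Set (Σ W : Type, SimpleGraph W)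

/-- `G` is `M`-free: no member of `M` is isomorphic to an induced subgraph of `G`. -/
def FamilyFree (M : GraphFamily) {V : Type u} (G : SimpleGraph V) : Prop :=
  ∀ H ∈ M, ¬ H.2.IsIndContained G

/-! ### Intersection graphs of intervals -/

/-- `G` is an `N`-graph: it has an intersection representation by members of `N`. -/
def IsIntersectionGraph (N : Set (Set ℝ)) {V : Type u} (G : SimpleGraph V) : Prop :=
  ∃ f : V → Set ℝ, (∀ v, f v ∈ N) ∧
    ∀ x y : V, x ≠ y → (G.Adj x y ↔ (f x ∩ f y).Nonempty)

/-- The (nonempty) closed, open, open-closed and closed-open intervals with real end points. -/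
def intervals : Set (Set ℝ) :=
  {A | A.Nonempty ∧ ∃ a b : ℝ,
    A = Set.Icc a b ∨ A = Set.Ioo a b ∨ A = Set.Ioc a b ∨ A = Set.Ico a b}

/-- The closed, open, open-closed and closed-open intervals of length one. -/
def unitIntervals : Set (Set ℝ) :=
  {A | ∃ a : ℝ, A = Set.Icc a (a + 1) ∨ A = Set.Ioo a (a + 1) ∨
    A = Set.Ioc a (a + 1) ∨ A = Set.Ico a (a + 1)}

/-- Interval graphs. -/
def IsIntervalGraph {V : Type u} (G : SimpleGraph V) : Prop :=
  IsIntersectionGraph intervals G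

/-- Mixed unit interval graphs. -/
def IsMixedUnitIntervalGraph {V : Type u} (G : SimpleGraph V) : Prop :=
  IsIntersectionGraph unitIntervals G

/-! ### The forbidden graphs -/

/-- `K_{2,3}^*`: the complete bipartite graph `K_{2,3}` together with the edge joining the two
vertices of the part of size two. -/
def graphK23 : SimpleGraph (Fin 2 ⊕ Fin 3) :=
  SimpleGraph.fromRel fun x _ => x.isLeft = true

/-- The graph obtained from `G` by adding a new vertex `none` with neighbourhood `A`. -/
def addVertex {W : Type} (G : SimpleGraph W) (A : Set W) : SimpleGraph (Option W) :=
  SimpleGraph.fromRel fun x y =>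
    match x, y with
    | some a, some b => G.Adj a b
    | none, some b => b ∈ A
    | _, _ => False

/-- The vertices of the triangle strip `Q_k`: `inl` lists the lower row `b_0, …, b_{k+1}` and
`inr` lists the upper row `t_0, …, t_k`. -/
abbrev VertQ (k : ℕ) : Type := Fin (k + 2) ⊕ Fin (k + 1)

/-- The triangle strip `Q_k`. The lower row is a path `b_0 b_1 … b_{k+1}`; the vertex `t_0` is
adjacent to `b_1` only, and `t_j` with `1 ≤ j ≤ k` is adjacent to exactly `b_j` and `b_{j+1}`.
So `b_0`, `t_0` are pendant vertices at `b_1`, followed by the `k` triangles `b_j t_j b_{j+1}`. -/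
def graphQ (k : ℕ) : SimpleGraph (VertQ k) :=
  SimpleGraph.fromRel fun x y =>
    match x, y with
    | Sum.inl i, Sum.inl j => (j : ℕ) = (i : ℕ) + 1
    | Sum.inr i, Sum.inl j =>
        (j : ℕ) = (i : ℕ) + 1 ∨ ((i : ℕ) ≠ 0 ∧ (j : ℕ) = (i : ℕ))
    | _, _ => False

/-- The last lower vertex `b_{k+1}` of `Q_k`; one of the two special vertices. -/
def specialV (k : ℕ) : VertQ k := Sum.inl (Fin.last (k + 1))

/-- The last upper vertex `t_k` of `Q_k`; the other special vertex. -/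
def specialW (k : ℕ) : VertQ k := Sum.inr (Fin.last k)

/-- The vertex `b_k` of `Q_k`; for `k ≥ 1` the common neighbour of the two special vertices. -/
def hubQ (k : ℕ) : VertQ k := Sum.inl (Fin.last k).castSucc

/-- `R_k`: the strip `Q_k` with two further pendant vertices attached to `b_{k+1}`
(so `R_0 = K_{1,4}`). -/
def graphR (k : ℕ) : SimpleGraph (Option (Option (VertQ k))) :=
  addVertex (addVertex (graphQ k) {specialV k}) {some (specialV k)}

/-- `S_{k+1}`: the strip `Q_{k+1}` with a further vertex adjacent to exactly
`t_{k+1}`, `b_{k+1}` and `t_k`. -/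
def graphS (k : ℕ) : SimpleGraph (Option (VertQ (k + 1))) :=
  addVertex (graphQ (k + 1))
    {specialW (k + 1), hubQ (k + 1), Sum.inr (Fin.last k).castSucc}

/-- `S'_{k+1}`: the strip `Q_{k+1}` with a further vertex adjacent to exactly
the two special vertices `b_{k+2}`, `t_{k+1}` and their common neighbour `b_{k+1}`. -/
def graphS' (k : ℕ) : SimpleGraph (Option (VertQ (k + 1))) :=
  addVertex (graphQ (k + 1)) {specialV (k + 1), specialW (k + 1), hubQ (k + 1)}

/-- `T_{i,j}`: the disjoint union of the strips `Q_i` and `Q_j`, together with three of the four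
edges between their special vertices, the missing one being the edge between the two last upper
vertices. -/
def graphT (i j : ℕ) : SimpleGraph (VertQ i ⊕ VertQ j) :=
  SimpleGraph.fromRel fun x y =>
    match x, y with
    | Sum.inl a, Sum.inl b => (graphQ i).Adj a b
    | Sum.inr a, Sum.inr b => (graphQ j).Adj a b
    | Sum.inl a, Sum.inr b =>
        (a = specialV i ∧ b = specialV j) ∨ (a = specialV i ∧ b = specialW j) ∨
          (a = specialW i ∧ b = specialV j)
    | _, _ => False

/-- `𝓡 = {R_0, R_1, …}`. -/
def familyR : GraphFamily := {H | ∃ k : ℕ, H = ⟨_, graphR k⟩}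

/-- `𝓢 = {S_1, S_2, …}`. -/
def familyS : GraphFamily := {H | ∃ k : ℕ, H = ⟨_, graphS k⟩}

/-- `𝓢' = {S'_1, S'_2, …}`. -/
def familyS' : GraphFamily := {H | ∃ k : ℕ, H = ⟨_, graphS' k⟩}

/-- `𝓣 = {T_{i,j} : i ≥ j ≥ 0}`. -/
def familyT : GraphFamily := {H | ∃ i j : ℕ, j ≤ i ∧ H = ⟨_, graphT i j⟩}

/-- `{K_{2,3}^*} ∪ 𝓡 ∪ 𝓢 ∪ 𝓢' ∪ 𝓣`. -/
def forbidden : GraphFamily :=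
  {⟨_, graphK23⟩} ∪ familyR ∪ familyS ∪ familyS' ∪ familyT

end MixedUnitInterval

namespace MixedUnitInterval

universe u

variable {V : Type u} {G : SimpleGraph V}

/-! ### Adjacency in the forbidden graphs -/

section Adjacency

variable {k : ℕ} {W : Type} {H : SimpleGraph W} {A : Set W}

/-! Necessity. In a unit representation the leaves of a claw lie at distance -1, 0 and 1 from the
centre, so the middle leaf sits exactly on the centre; it is open at both ends and the centre is
closed at both. Twin-freeness leaves at most one interval of each end type at a given position.
These facts propagate along a strip (`UnitRep.tight`): `t j` and `b (j + 1)` share a position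
exactly one unit away from `b j`. Each forbidden graph then needs three independent intervals on two
sides, twins at one position, or two closed ends meeting at a point without adjacency.

Sufficiency. Represent the graph by intervals of integers, the indices of the maximal cliques
(`exists_cliqueModel`). An interval strictly inside another must, in any unit representation, share
both its ends and be open; intervals touching such a coincident pair from one side must coincide
with each other in turn, and so on. `LeftPair` records the coincidences of left ends forced in this
way, and `CliqueModel.flip` supplies those of right ends. A left pair of depth `k` is the end of an
induced strip `Q_k` (`LeftPair.exists_strip`). Hence excluding `K_{2,3}^*`, `R`, `S`, `S'` and `T`
makes the two left ends consecutive and lets at most two intervals touch the pair (`good`), and also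
keeps left pairs and right pairs apart (`LeftPair.not_clash`).

Now shift every forced open end by one integer onto its partner. No modified interval has another in
its interior (`not_nested`), but some disjoint intervals now touch. Ties at each integer are broken
so that left ends and right ends occur in the same order, with equality exactly where disjoint
intervals touch at an open end or where closed ends may meet. A finite family whose left and right
ends are ordered alike can be stretched to unit length (`exists_unit_scale`). -/

theorem graphQ_adj_inl_inl {i j : Fin (k + 2)} :
    (graphQ k).Adj (.inl i) (.inl j) ↔ (j : ℕ) = i + 1 ∨ (i : ℕ) = j + 1 := by
  simp only [graphQ, SimpleGraph.fromRel_adj, ne_eq, Sum.inl.injEq, and_iff_right_iff_imp, Fin.ext_iff]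
  omega

theorem graphQ_adj_inr_inl {i : Fin (k + 1)} {j : Fin (k + 2)} :
    (graphQ k).Adj (.inr i) (.inl j) ↔ (j : ℕ) = i + 1 ∨ ((i : ℕ) ≠ 0 ∧ (j : ℕ) = i) := by
  simp [graphQ, SimpleGraph.fromRel_adj]

theorem graphQ_not_adj_inr_inr {i j : Fin (k + 1)} :
    ¬ (graphQ k).Adj (.inr i) (.inr j) := by
  simp [graphQ, SimpleGraph.fromRel_adj]

theorem addVertex_adj_some_some {a b : W} :
    (addVertex H A).Adj (some a) (some b) ↔ H.Adj a b := by
  simp only [addVertex, SimpleGraph.fromRel_adj, ne_eq, Option.some.injEq, H.adj_comm b a, or_self]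
  exact ⟨fun h => h.2, fun h => ⟨h.ne, h⟩⟩

theorem addVertex_adj_none_some {b : W} :
    (addVertex H A).Adj none (some b) ↔ b ∈ A := by
  simp [addVertex, SimpleGraph.fromRel_adj]

theorem graphT_adj_inl_inl {i j : ℕ} {a b : VertQ i} :
    (graphT i j).Adj (.inl a) (.inl b) ↔ (graphQ i).Adj a b := by
  simp only [graphT, SimpleGraph.fromRel_adj, ne_eq, Sum.inl.injEq, (graphQ i).adj_comm b a,
    or_self]
  exact ⟨fun h => h.2, fun h => ⟨h.ne, h⟩⟩

theorem graphT_adj_inr_inr {i j : ℕ} {a b : VertQ j} :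
    (graphT i j).Adj (.inr a) (.inr b) ↔ (graphQ j).Adj a b := by
  simp only [graphT, SimpleGraph.fromRel_adj, ne_eq, Sum.inr.injEq, (graphQ j).adj_comm b a,
    or_self]
  exact ⟨fun h => h.2, fun h => ⟨h.ne, h⟩⟩

theorem graphT_adj_inl_inr {i j : ℕ} {a : VertQ i} {b : VertQ j} :
    (graphT i j).Adj (.inl a) (.inr b) ↔
      (a = specialV i ∧ b = specialV j) ∨ (a = specialV i ∧ b = specialW j) ∨
          (a = specialW i ∧ b = specialV j) := by
  simp [graphT, SimpleGraph.fromRel_adj]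

theorem graphK23_adj_inl_inl {i j : Fin 2} :
    graphK23.Adj (.inl i) (.inl j) ↔ i ≠ j := by
  simp [graphK23, SimpleGraph.fromRel_adj]

theorem graphK23_adj_inl_inr {i : Fin 2} {j : Fin 3} : graphK23.Adj (.inl i) (.inr j) := by
  simp [graphK23, SimpleGraph.fromRel_adj]

theorem graphK23_not_adj_inr_inr {i j : Fin 3} : ¬ graphK23.Adj (.inr i) (.inr j) := by
  simp [graphK23, SimpleGraph.fromRel_adj]

/-- An induced copy of `H` and a vertex attached to it along `A` give an induced copy of
`addVertex H A`. -/
def addVertexEmbedding (f : H ↪g G) (s : V) (hs : ∀ y, s ≠ f y)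
    (hA : ∀ y, G.Adj s (f y) ↔ y ∈ A) : addVertex H A ↪g G where
  toFun := fun o => o.elim s f
  inj' := by
    rintro (_ | a) (_ | b) h
    · rfl
    · exact (hs b h).elim
    · exact (hs a h.symm).elim
    · exact congrArg some (f.injective h)
  map_rel_iff' := by
    rintro (_ | a) (_ | b)
    · simp
    · exact (hA b).trans addVertex_adj_none_some.symm
    · rw [SimpleGraph.adj_comm, (addVertex H A).adj_comm]
      exact (hA a).trans addVertex_adj_none_some.symm
    · exact f.map_adj_iff.trans addVertex_adj_some_some.symm

/-- The copy of `H` inside `addVertex H A`. -/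
def someEmbedding (H : SimpleGraph W) (A : Set W) : H ↪g addVertex H A where
  toFun := some
  inj' := Option.some_injective _
  map_rel_iff' := addVertex_adj_some_some

/-- The first strip of `graphT i j`. -/
def inlEmbedding (i j : ℕ) : graphQ i ↪g graphT i j where
  toFun := Sum.inl
  inj' := Sum.inl_injective
  map_rel_iff' := graphT_adj_inl_inl

/-- The second strip of `graphT i j`. -/
def inrEmbedding (i j : ℕ) : graphQ j ↪g graphT i j where
  toFun := Sum.inr
  inj' := Sum.inr_injective
  map_rel_iff' := graphT_adj_inr_inr

end Adjacency

/-! ### Induced strips -/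

/-- The vertices `b 0, …, b (k + 1)` and `t 0, …, t k` form an induced copy of `Q_k`. -/
structure IsStrip (G : SimpleGraph V) (k : ℕ) (b t : ℕ → V) : Prop where
  bb : ∀ i j, i < j → j ≤ k + 1 → (G.Adj (b i) (b j) ↔ j = i + 1)
  tb : ∀ i j, i ≤ k → j ≤ k + 1 → (G.Adj (t i) (b j) ↔ j = i + 1 ∨ i ≠ 0 ∧ j = i)
  tt : ∀ i j, i < j → j ≤ k → ¬ G.Adj (t i) (t j)
  b_ne : ∀ i j, i < j → j ≤ k + 1 → b i ≠ b j
  tb_ne : ∀ i j, i ≤ k → j ≤ k + 1 → t i ≠ b j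
  t_ne : ∀ i j, i < j → j ≤ k → t i ≠ t j

/-- The vertex `s` outside the strip is attached to it exactly at `b (k + 1)`. -/
structure IsPendant (G : SimpleGraph V) (k : ℕ) (b t : ℕ → V) (s : V) : Prop where
  adj : G.Adj s (b (k + 1))
  b_ne : ∀ j ≤ k, s ≠ b j
  b_not_adj : ∀ j ≤ k, ¬ G.Adj s (b j)
  t_ne : ∀ j ≤ k, s ≠ t j
  t_not_adj : ∀ j ≤ k, ¬ G.Adj s (t j)

namespace IsStrip

variable {k : ℕ} {b t : ℕ → V}

/-- An induced strip as an embedding of `graphQ k`. -/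
def embedding (h : IsStrip G k b t) : graphQ k ↪g G where
  toFun := Sum.elim (fun i => b i) (fun i => t i)
  inj' := by
    rintro (i | i) (j | j) e
    · rcases lt_trichotomy (i : ℕ) j with hij | hij | hij
      · exact (h.b_ne i j hij (by omega) e).elim
      · exact congrArg Sum.inl (Fin.ext hij)
      · exact (h.b_ne j i hij (by omega) e.symm).elim
    · exact (h.tb_ne j i (by omega) (by omega) e.symm).elim
    · exact (h.tb_ne i j (by omega) (by omega) e).elim
    · rcases lt_trichotomy (i : ℕ) j with hij | hij | hij
      · exact (h.t_ne i j hij (by omega) e).elim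
      · exact congrArg Sum.inr (Fin.ext hij)
      · exact (h.t_ne j i hij (by omega) e.symm).elim
  map_rel_iff' := by
    rintro (i | i) (j | j)
    · change G.Adj (b i) (b j) ↔ _
      rw [graphQ_adj_inl_inl]
      rcases lt_trichotomy (i : ℕ) j with hij | hij | hij
      · rw [h.bb i j hij (by omega)]; omega
      · simp [hij]
      · rw [G.adj_comm, h.bb j i hij (by omega)]; omega
    · change G.Adj (b i) (t j) ↔ _
      rw [G.adj_comm, (graphQ k).adj_comm, graphQ_adj_inr_inl,
        h.tb j i (by omega) (by omega)]
    · change G.Adj (t i) (b j) ↔ _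
      rw [graphQ_adj_inr_inl, h.tb i j (by omega) (by omega)]
    · change G.Adj (t i) (t j) ↔ _
      simp only [graphQ_not_adj_inr_inr, iff_false]
      rcases lt_trichotomy (i : ℕ) j with hij | hij | hij
      · exact h.tt i j hij (by omega)
      · simp [hij]
      · rw [G.adj_comm]; exact h.tt j i hij (by omega)

theorem embedding_inl (h : IsStrip G k b t) (i : Fin (k + 2)) :
    h.embedding (.inl i) = b i := rfl

theorem embedding_inr (h : IsStrip G k b t) (i : Fin (k + 1)) :
    h.embedding (.inr i) = t i := rfl

/-- Every induced copy of `graphQ k` is a strip. -/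
theorem of_embedding (φ : graphQ k ↪g G) :
    IsStrip G k (fun j => φ (.inl (Fin.ofNat (k + 2) j)))
      (fun j => φ (.inr (Fin.ofNat (k + 1) j))) where
  bb i j hij hj := by
    rw [φ.map_adj_iff, graphQ_adj_inl_inl, Fin.val_ofNat, Fin.val_ofNat,
      Nat.mod_eq_of_lt (by omega), Nat.mod_eq_of_lt (by omega)]
    omega
  tb i j hi hj := by
    rw [φ.map_adj_iff, graphQ_adj_inr_inl, Fin.val_ofNat, Fin.val_ofNat,
      Nat.mod_eq_of_lt (by omega), Nat.mod_eq_of_lt (by omega)]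
  tt i j hij hj := by
    rw [φ.map_adj_iff]
    exact graphQ_not_adj_inr_inr
  b_ne i j hij hj e := by
    have := congrArg Fin.val (Sum.inl_injective (φ.injective e))
    rw [Fin.val_ofNat, Fin.val_ofNat, Nat.mod_eq_of_lt (by omega),
      Nat.mod_eq_of_lt (by omega)] at this
    omega
  tb_ne i j hi hj e := by cases φ.injective e
  t_ne i j hij hj e := by
    have := congrArg Fin.val (Sum.inr_injective (φ.injective e))
    rw [Fin.val_ofNat, Fin.val_ofNat, Nat.mod_eq_of_lt (by omega),
      Nat.mod_eq_of_lt (by omega)] at this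
    omega

/-- Two adjacent vertices attached at the end of a strip prolong it. -/
theorem extend (h : IsStrip G k b t) {s s' : V} (hs : IsPendant G k b t s)
    (hs' : IsPendant G k b t s') (hss : G.Adj s s') :
    IsStrip G (k + 1) (Function.update b (k + 2) s) (Function.update t (k + 1) s') where
  bb i j hij hj := by
    rw [Function.update_of_ne (by omega : i ≠ k + 2)]
    by_cases hjk : j = k + 2
    · subst hjk
      rw [Function.update_self]
      by_cases hi : i = k + 1
      · simp [hi, hs.adj.symm]
      · have := hs.b_not_adj i (by omega)
        rw [G.adj_comm] at this
        simp only [this, false_iff]; omega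
    · rw [Function.update_of_ne hjk]; exact h.bb i j hij (by omega)
  tb i j hi hj := by
    by_cases hjk : j = k + 2
    · subst hjk
      rw [Function.update_self]
      by_cases hik : i = k + 1
      · subst hik; simp [hss.symm]
      · rw [Function.update_of_ne hik, G.adj_comm]
        have := hs.t_not_adj i (by omega)
        simp only [this, false_iff]; omega
    · rw [Function.update_of_ne hjk]
      by_cases hik : i = k + 1
      · subst hik
        rw [Function.update_self]
        by_cases hjk' : j = k + 1
        · subst hjk'; simp [hs'.adj]
        · simp only [hs'.b_not_adj j (by omega), false_iff]; omega
      · rw [Function.update_of_ne hik]; exact h.tb i j (by omega) (by omega)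
  tt i j hij hj := by
    rw [Function.update_of_ne (by omega : i ≠ k + 1)]
    by_cases hjk : j = k + 1
    · subst hjk
      rw [Function.update_self, G.adj_comm]
      exact hs'.t_not_adj i (by omega)
    · rw [Function.update_of_ne hjk]; exact h.tt i j hij (by omega)
  b_ne i j hij hj := by
    rw [Function.update_of_ne (by omega : i ≠ k + 2)]
    by_cases hjk : j = k + 2
    · subst hjk
      rw [Function.update_self]
      by_cases hi : i = k + 1
      · rw [hi]; exact hs.adj.ne'
      · exact (hs.b_ne i (by omega)).symm
    · rw [Function.update_of_ne hjk]; exact h.b_ne i j hij (by omega)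
  tb_ne i j hi hj := by
    by_cases hjk : j = k + 2
    · subst hjk
      rw [Function.update_self]
      by_cases hik : i = k + 1
      · subst hik; rw [Function.update_self]; exact hss.ne'
      · rw [Function.update_of_ne hik]
        exact (hs.t_ne i (by omega)).symm
    · rw [Function.update_of_ne hjk]
      by_cases hik : i = k + 1
      · subst hik
        rw [Function.update_self]
        by_cases hjk' : j = k + 1
        · subst hjk'; exact hs'.adj.ne
        · exact hs'.b_ne j (by omega)
      · rw [Function.update_of_ne hik]; exact h.tb_ne i j (by omega) (by omega)
  t_ne i j hij hj := by
    rw [Function.update_of_ne (by omega : i ≠ k + 1)]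
    by_cases hjk : j = k + 1
    · subst hjk
      rw [Function.update_self]
      exact (hs'.t_ne i (by omega)).symm
    · rw [Function.update_of_ne hjk]; exact h.t_ne i j hij (by omega)

end IsStrip

/-! ### Forbidden configurations -/

section Forbidden

variable {k : ℕ} {b t : ℕ → V}

/-- Two independent pendants would complete the strip to `graphR k`. -/
theorem FamilyFree.adj_of_isPendant (hG : FamilyFree forbidden G) (h : IsStrip G k b t) {s s' : V}
    (hs : IsPendant G k b t s) (hs' : IsPendant G k b t s') (hne : s ≠ s') : G.Adj s s' := by
  by_contra hss
  refine hG ⟨_, graphR k⟩ (.inl (.inl (.inl (.inr ⟨k, rfl⟩)))) ⟨addVertexEmbedding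
    (addVertexEmbedding (A := {specialV k}) h.embedding s ?_ ?_) s' ?_ ?_⟩
  · rintro (j | j)
    · rw [h.embedding_inl]
      rcases Nat.lt_or_ge k j with hj | hj
      · rw [(by omega : (j : ℕ) = k + 1)]; exact hs.adj.ne
      · exact hs.b_ne _ hj
    · exact hs.t_ne _ (by omega)
  · rintro (j | j)
    · rw [h.embedding_inl]
      rcases Nat.lt_or_ge k j with hj | hj
      · simp [(by omega : (j : ℕ) = k + 1), hs.adj, specialV, Fin.ext_iff]
      · simp only [hs.b_not_adj _ hj, specialV, Fin.ext_iff, Set.mem_singleton_iff, Sum.inl.injEq,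
          Fin.val_last, false_iff]
        omega
    · rw [h.embedding_inr]
      simpa [specialV] using hs.t_not_adj _ (by omega)
  · rintro (_ | j | j)
    · exact hne.symm
    · change s' ≠ b j
      rcases Nat.lt_or_ge k j with hj | hj
      · rw [(by omega : (j : ℕ) = k + 1)]; exact hs'.adj.ne
      · exact hs'.b_ne _ hj
    · exact hs'.t_ne _ (by omega)
  · rintro (_ | j | j)
    · change G.Adj s' s ↔ _
      simp [G.adj_comm s' s, hss]
    · change G.Adj s' (b j) ↔ _
      rcases Nat.lt_or_ge k j with hj | hj
      · simp [(by omega : (j : ℕ) = k + 1), hs'.adj, specialV, Fin.ext_iff]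
      · simp only [hs'.b_not_adj _ hj, specialV, Fin.ext_iff, Set.mem_singleton_iff,
          Option.some.injEq, Sum.inl.injEq, Fin.val_last, false_iff]
        omega
    · change G.Adj s' (t j) ↔ _
      simpa [specialV] using hs'.t_not_adj _ (by omega)

/-- Two of the pendants prolong the strip by a triangle; the third completes it to `graphS' k`. -/
theorem FamilyFree.not_three_isPendant (hG : FamilyFree forbidden G) (h : IsStrip G k b t)
    {s₁ s₂ s₃ : V} (h₁ : IsPendant G k b t s₁) (h₂ : IsPendant G k b t s₂)
    (h₃ : IsPendant G k b t s₃) (h₁₂ : G.Adj s₁ s₂) (h₁₃ : G.Adj s₃ s₁) (h₂₃ : G.Adj s₃ s₂) :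
    False := by
  have hq := h.extend h₁ h₂ h₁₂
  refine hG ⟨_, graphS' k⟩ (.inl (.inr ⟨k, rfl⟩)) ⟨addVertexEmbedding hq.embedding s₃ ?_ ?_⟩
  · rintro (j | j)
    · rw [hq.embedding_inl]
      by_cases hj : (j : ℕ) = k + 2
      · rw [hj, Function.update_self]; exact h₁₃.ne
      · rw [Function.update_of_ne hj]
        by_cases hj' : (j : ℕ) = k + 1
        · rw [hj']; exact h₃.adj.ne
        · exact h₃.b_ne _ (by omega)
    · rw [hq.embedding_inr]
      by_cases hj : (j : ℕ) = k + 1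
      · rw [hj, Function.update_self]; exact h₂₃.ne
      · rw [Function.update_of_ne hj]; exact h₃.t_ne _ (by omega)
  · rintro (j | j)
    · rw [hq.embedding_inl]
      by_cases hj : (j : ℕ) = k + 2
      · simp [hj, specialV, specialW, hubQ, Fin.ext_iff, h₁₃]
      · rw [Function.update_of_ne hj]
        by_cases hj' : (j : ℕ) = k + 1
        · simp [hj', specialV, specialW, hubQ, Fin.ext_iff, h₃.adj]
        · simp [specialV, specialW, hubQ, Fin.ext_iff, h₃.b_not_adj j (by omega)]
          omega
    · rw [hq.embedding_inr]
      by_cases hj : (j : ℕ) = k + 1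
      · simp [hj, specialV, specialW, hubQ, Fin.ext_iff, h₂₃]
      · rw [Function.update_of_ne hj]
        simp [hj, specialV, specialW, hubQ, Fin.ext_iff, h₃.t_not_adj j (by omega)]

/-- The pendants prolong the strip with `s₁` as last lower and `s₂` as last upper vertex; `s`
completes it to `graphS k`. -/
theorem FamilyFree.not_two_isPendant_linked (hG : FamilyFree forbidden G) (h : IsStrip G k b t)
    {s₁ s₂ s : V} (h₁ : IsPendant G k b t s₁) (h₂ : IsPendant G k b t s₂) (h₁₂ : G.Adj s₁ s₂)
    (hs₁ : s ≠ s₁) (hs₁' : ¬ G.Adj s s₁) (hs₂ : G.Adj s s₂)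
    (hb : G.Adj s (b (k + 1))) (ht : G.Adj s (t k))
    (hb' : ∀ j ≤ k, s ≠ b j ∧ ¬ G.Adj s (b j)) (ht' : ∀ j < k, s ≠ t j ∧ ¬ G.Adj s (t j)) :
    False := by
  have hq := h.extend h₁ h₂ h₁₂
  refine hG ⟨_, graphS k⟩ (.inl (.inl (.inr ⟨k, rfl⟩))) ⟨addVertexEmbedding hq.embedding s ?_ ?_⟩
  · rintro (j | j)
    · rw [hq.embedding_inl]
      by_cases hj : (j : ℕ) = k + 2
      · rw [hj, Function.update_self]; exact hs₁
      · rw [Function.update_of_ne hj]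
        by_cases hj' : (j : ℕ) = k + 1
        · rw [hj']; exact hb.ne
        · exact (hb' _ (by omega)).1
    · rw [hq.embedding_inr]
      by_cases hj : (j : ℕ) = k + 1
      · rw [hj, Function.update_self]; exact hs₂.ne
      · rw [Function.update_of_ne hj]
        by_cases hj' : (j : ℕ) = k
        · rw [hj']; exact ht.ne
        · exact (ht' _ (by omega)).1
  · rintro (j | j)
    · rw [hq.embedding_inl]
      by_cases hj : (j : ℕ) = k + 2
      · simp [hj, specialW, hubQ, Fin.ext_iff, hs₁']
      · rw [Function.update_of_ne hj]
        by_cases hj' : (j : ℕ) = k + 1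
        · simp [hj', specialW, hubQ, Fin.ext_iff, hb]
        · simp [hj', specialW, hubQ, Fin.ext_iff, (hb' j (by omega)).2]
    · rw [hq.embedding_inr]
      by_cases hj : (j : ℕ) = k + 1
      · simp [hj, specialW, hubQ, Fin.ext_iff, hs₂]
      · rw [Function.update_of_ne hj]
        by_cases hj' : (j : ℕ) = k
        · simp [hj', specialW, hubQ, Fin.ext_iff, ht]
        · simp [hj, hj', specialW, hubQ, Fin.ext_iff, (ht' j (by omega)).2]

/-- The two strips with these three links induce a member of `familyT`, the longer strip being
listed first. -/
theorem FamilyFree.not_two_isStrip_linked (hG : FamilyFree forbidden G) {k' : ℕ} {b' t' : ℕ → V}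
    (h : IsStrip G k b t) (h' : IsStrip G k' b' t')
    (hbb : G.Adj (b (k + 1)) (b' (k' + 1))) (hbt : G.Adj (b (k + 1)) (t' k'))
    (htb : G.Adj (t k) (b' (k' + 1))) (htt : t k ≠ t' k') (htt' : ¬ G.Adj (t k) (t' k'))
    (hb : ∀ j ≤ k, (∀ i ≤ k' + 1, b j ≠ b' i ∧ ¬ G.Adj (b j) (b' i)) ∧
      ∀ i ≤ k', b j ≠ t' i ∧ ¬ G.Adj (b j) (t' i))
    (ht : ∀ j < k, (∀ i ≤ k' + 1, t j ≠ b' i ∧ ¬ G.Adj (t j) (b' i)) ∧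
      ∀ i ≤ k', t j ≠ t' i ∧ ¬ G.Adj (t j) (t' i))
    (hb' : ∀ j ≤ k', (∀ i ≤ k + 1, b i ≠ b' j ∧ ¬ G.Adj (b i) (b' j)) ∧
      ∀ i ≤ k, t i ≠ b' j ∧ ¬ G.Adj (t i) (b' j))
    (ht' : ∀ j < k', (∀ i ≤ k + 1, b i ≠ t' j ∧ ¬ G.Adj (b i) (t' j)) ∧
      ∀ i ≤ k, t i ≠ t' j ∧ ¬ G.Adj (t i) (t' j)) : False := by
  have key : ∀ (x : VertQ k) (y : VertQ k'), h.embedding x ≠ h'.embedding y ∧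
      (G.Adj (h.embedding x) (h'.embedding y) ↔ (x = specialV k ∧ y = specialV k') ∨
        (x = specialV k ∧ y = specialW k') ∨ (x = specialW k ∧ y = specialV k')) := by
    rintro (i | i) (j | j)
    · rw [h.embedding_inl, h'.embedding_inl]
      simp only [specialV, specialW, Sum.inl.injEq, Fin.ext_iff, Fin.val_last, reduceCtorEq]
      by_cases hi : (i : ℕ) = k + 1
      · by_cases hj : (j : ℕ) = k' + 1
        · rw [hi, hj]; simp [hbb, hbb.ne]
        · have := (hb' j (by omega)).1 i (by omega)
          simp [hj, this]
      · have := (hb i (by omega)).1 j (by omega)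
        simp [hi, this]
    · rw [h.embedding_inl, h'.embedding_inr]
      simp only [specialV, specialW, Sum.inl.injEq, Sum.inr.injEq, Fin.ext_iff, Fin.val_last,
        reduceCtorEq]
      by_cases hi : (i : ℕ) = k + 1
      · by_cases hj : (j : ℕ) = k'
        · rw [hi, hj]; simp [hbt, hbt.ne]
        · have := (ht' j (by omega)).1 i (by omega)
          simp [hj, this]
      · have := (hb i (by omega)).2 j (by omega)
        simp [hi, this]
    · rw [h.embedding_inr, h'.embedding_inl]
      simp only [specialV, specialW, Sum.inl.injEq, Sum.inr.injEq, Fin.ext_iff, Fin.val_last,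
        reduceCtorEq]
      by_cases hi : (i : ℕ) = k
      · by_cases hj : (j : ℕ) = k' + 1
        · rw [hi, hj]; simp [htb, htb.ne]
        · have := (hb' j (by omega)).2 i (by omega)
          simp [hj, this]
      · have := (ht i (by omega)).1 j (by omega)
        simp [hi, this]
    · rw [h.embedding_inr, h'.embedding_inr]
      simp only [specialV, specialW, reduceCtorEq]
      by_cases hi : (i : ℕ) = k
      · by_cases hj : (j : ℕ) = k'
        · rw [hi, hj]; simp [htt', htt]
        · have := (ht' j (by omega)).2 i (by omega)
          simp [this]
      · have := (ht i (by omega)).2 j (by omega)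
        simp [this]
  rcases le_total k' k with hk | hk
  · refine hG ⟨_, graphT k k'⟩ (.inr ⟨k, k', hk, rfl⟩)
      ⟨⟨⟨Sum.elim h.embedding h'.embedding, ?_⟩, ?_⟩⟩
    · exact h.embedding.injective.sumElim h'.embedding.injective fun x y => (key x y).1
    · rintro (x | x) (y | y)
      · exact h.embedding.map_adj_iff.trans graphT_adj_inl_inl.symm
      · exact (key x y).2.trans graphT_adj_inl_inr.symm
      · rw [G.adj_comm, (graphT k k').adj_comm]
        exact (key y x).2.trans graphT_adj_inl_inr.symm
      · exact h'.embedding.map_adj_iff.trans graphT_adj_inr_inr.symm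
  -- The set of cross edges is symmetric under exchanging the two strips, so `graphT k' k` serves
  -- when the second strip is the longer one.
  · have hsymm : ∀ (x : VertQ k) (y : VertQ k'), ((x = specialV k ∧ y = specialV k') ∨
        (x = specialV k ∧ y = specialW k') ∨ (x = specialW k ∧ y = specialV k')) ↔
        ((y = specialV k' ∧ x = specialV k) ∨
        (y = specialV k' ∧ x = specialW k) ∨ (y = specialW k' ∧ x = specialV k)) := by
      intro x y; tauto
    refine hG ⟨_, graphT k' k⟩ (.inr ⟨k', k, hk, rfl⟩)
      ⟨⟨⟨Sum.elim h'.embedding h.embedding, ?_⟩, ?_⟩⟩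
    · exact h'.embedding.injective.sumElim h.embedding.injective fun x y => (key y x).1.symm
    · rintro (x | x) (y | y)
      · exact h'.embedding.map_adj_iff.trans graphT_adj_inl_inl.symm
      · rw [G.adj_comm]
        exact ((key y x).2.trans (hsymm y x)).trans graphT_adj_inl_inr.symm
      · rw [(graphT k' k).adj_comm]
        exact ((key x y).2.trans (hsymm x y)).trans graphT_adj_inl_inr.symm
      · exact h.embedding.map_adj_iff.trans graphT_adj_inr_inr.symm

theorem FamilyFree.not_two_centers (hG : FamilyFree forbidden G) {p q a u c : V}
    (hpq : G.Adj p q) (hpa : G.Adj p a) (hpu : G.Adj p u) (hpc : G.Adj p c)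
    (hqa : G.Adj q a) (hqu : G.Adj q u) (hqc : G.Adj q c)
    (hau : a ≠ u) (hac : a ≠ c) (huc : u ≠ c)
    (hau' : ¬ G.Adj a u) (hac' : ¬ G.Adj a c) (huc' : ¬ G.Adj u c) : False := by
  refine hG ⟨_, graphK23⟩ (by simp [forbidden])
      ⟨⟨⟨Sum.elim ![p, q] ![a, u, c], ?_⟩, ?_⟩⟩
  · rintro (x | x) (y | y) <;> fin_cases x <;> fin_cases y <;>
      simp [hpq.ne, hpq.ne', hpa.ne, hpa.ne', hpu.ne, hpu.ne', hpc.ne, hpc.ne', hqa.ne, hqa.ne',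
        hqu.ne, hqu.ne', hqc.ne, hqc.ne', hau, hac, huc, hau.symm, hac.symm, huc.symm]
  · rintro (x | x) (y | y)
    · change G.Adj (![p, q] x) (![p, q] y) ↔ _
      rw [graphK23_adj_inl_inl]
      fin_cases x <;> fin_cases y <;> simp [hpq, hpq.symm]
    · change G.Adj (![p, q] x) (![a, u, c] y) ↔ _
      simp only [graphK23_adj_inl_inr, iff_true]
      fin_cases x <;> fin_cases y <;> simp [*]
    · change G.Adj (![a, u, c] x) (![p, q] y) ↔ _
      rw [G.adj_comm, graphK23.adj_comm]
      simp only [graphK23_adj_inl_inr, iff_true]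
      fin_cases x <;> fin_cases y <;> simp [*]
    · change G.Adj (![a, u, c] x) (![a, u, c] y) ↔ _
      simp only [graphK23_not_adj_inr_inr, iff_false]
      fin_cases x <;> fin_cases y <;>
        simp [hau', hac', huc', G.adj_comm u a, G.adj_comm c a, G.adj_comm c u]

end Forbidden

/-! ### Unit intervals with prescribed end points -/

/-- The unit interval with left end point `x` which contains its left (right) end point if and only
if `l` (`r`) holds. -/
def unitInterval (x : ℝ) (l r : Prop) : Set ℝ :=
  {z | (x < z ∨ z = x ∧ l) ∧ (z < x + 1 ∨ z = x + 1 ∧ r)}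

theorem unitInterval_mem (x : ℝ) (l r : Prop) : unitInterval x l r ∈ unitIntervals := by
  refine ⟨x, ?_⟩
  by_cases hl : l <;> by_cases hr : r
  · left; ext z; simp [unitInterval, hl, hr, le_iff_lt_or_eq, eq_comm]
  · right; right; right; ext z; simp [unitInterval, hl, hr, le_iff_lt_or_eq, eq_comm]
  · right; right; left; ext z; simp [unitInterval, hl, hr, le_iff_lt_or_eq]
  · right; left; ext z; simp [unitInterval, hl, hr]

theorem exists_eq_unitInterval {A : Set ℝ} (hA : A ∈ unitIntervals) :
    ∃ x l r, A = unitInterval x l r := by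
  obtain ⟨a, rfl | rfl | rfl | rfl⟩ := hA
  · exact ⟨a, True, True, by ext z; simp [unitInterval, le_iff_lt_or_eq, eq_comm]⟩
  · exact ⟨a, False, False, by ext z; simp [unitInterval]⟩
  · exact ⟨a, False, True, by ext z; simp [unitInterval, le_iff_lt_or_eq]⟩
  · exact ⟨a, True, False, by ext z; simp [unitInterval, le_iff_lt_or_eq, eq_comm]⟩

theorem unitInterval_inter_nonempty {x y : ℝ} {l r l' r' : Prop} :
    (unitInterval x l r ∩ unitInterval y l' r').Nonempty ↔
      (x < y + 1 ∨ x = y + 1 ∧ l ∧ r') ∧ (y < x + 1 ∨ y = x + 1 ∧ l' ∧ r) := by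
  constructor
  · rintro ⟨z, ⟨h1, h2⟩, h3, h4⟩
    constructor
    · rcases h1 with h1 | ⟨rfl, h1⟩ <;> rcases h4 with h4 | ⟨h4, h4'⟩
      · left; linarith
      · left; linarith
      · left; linarith
      · exact .inr ⟨h4, h1, h4'⟩
    · rcases h3 with h3 | ⟨rfl, h3⟩ <;> rcases h2 with h2 | ⟨h2, h2'⟩
      · left; linarith
      · left; linarith
      · left; linarith
      · exact .inr ⟨h2, h3, h2'⟩
  · rintro ⟨h1 | ⟨h1, hl, hr⟩, h2 | ⟨h2, hl', hr'⟩⟩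
    · refine ⟨(x + y + 1) / 2, ⟨.inl ?_, .inl ?_⟩, .inl ?_, .inl ?_⟩ <;> linarith
    · exact ⟨y, ⟨.inl (by linarith), .inr ⟨h2, hr'⟩⟩, .inr ⟨rfl, hl'⟩, .inl (by linarith)⟩
    · exact ⟨x, ⟨.inr ⟨rfl, hl⟩, .inl (by linarith)⟩, .inl (by linarith), .inr ⟨h1, hr⟩⟩
    · linarith

/-- A mixed unit interval representation: the left end point of each interval, and whether the
interval contains its left and its right end point. -/
structure UnitRep (G : SimpleGraph V) where
  x : V → ℝ
  leftClosed : V → Prop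
  rightClosed : V → Prop
  adj_iff : ∀ u v, u ≠ v → (G.Adj u v ↔
    (x u < x v + 1 ∨ x u = x v + 1 ∧ leftClosed u ∧ rightClosed v) ∧
      (x v < x u + 1 ∨ x v = x u + 1 ∧ leftClosed v ∧ rightClosed u))

theorem isMixedUnitIntervalGraph_iff : IsMixedUnitIntervalGraph G ↔ Nonempty (UnitRep G) := by
  constructor
  · rintro ⟨f, hf, hadj⟩
    choose x l r h using fun v => exists_eq_unitInterval (hf v)
    refine ⟨⟨x, l, r, fun u v huv => ?_⟩⟩
    rw [hadj u v huv, h, h, unitInterval_inter_nonempty]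
  · rintro ⟨R⟩
    refine ⟨fun v => unitInterval (R.x v) (R.leftClosed v) (R.rightClosed v),
      fun v => unitInterval_mem _ _ _, fun u v huv => ?_⟩
    rw [R.adj_iff u v huv, unitInterval_inter_nonempty]

theorem IsMixedUnitIntervalGraph.isIntervalGraph (h : IsMixedUnitIntervalGraph G) :
    IsIntervalGraph G := by
  obtain ⟨f, hf, hadj⟩ := h
  refine ⟨f, fun v => ?_, hadj⟩
  obtain ⟨a, ha⟩ := hf v
  refine ⟨⟨a + 1 / 2, ?_⟩, a, a + 1, ha⟩
  rcases ha with ha | ha | ha | ha <;> rw [ha] <;> constructor <;> linarith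

/-! ### Positions forced by claws and strips in a unit representation -/

namespace UnitRep

variable (R : UnitRep G) {a b c m o p s s' u v w : V}

theorem le_of_adj (h : G.Adj u v) : R.x u ≤ R.x v + 1 := by
  rcases ((R.adj_iff u v h.ne).1 h).1 with h | h
  · exact h.le
  · exact h.1.le

theorem closed_of_adj (h : G.Adj u v) (hx : R.x u = R.x v + 1) :
    R.leftClosed u ∧ R.rightClosed v := by
  rcases ((R.adj_iff u v h.ne).1 h).1 with h | h
  · exact (h.ne hx).elim
  · exact h.2

theorem adj_of_closed (hx : R.x u = R.x v + 1) (hu : R.leftClosed u) (hv : R.rightClosed v) :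
    G.Adj u v := by
  have hne : u ≠ v := by rintro rfl; linarith
  exact (R.adj_iff u v hne).2 ⟨.inr ⟨hx, hu, hv⟩, .inl (by linarith)⟩

theorem one_le_of_not_adj (hne : u ≠ v) (h : ¬ G.Adj u v) :
    R.x v + 1 ≤ R.x u ∨ R.x u + 1 ≤ R.x v := by
  by_contra! hc
  exact h ((R.adj_iff u v hne).2 ⟨.inl hc.1, .inl hc.2⟩)

/-- Consequently a position carries at most four intervals, one for each choice of included ends. -/
theorem eq_of_twin (hG : TwinFree G) (hx : R.x u = R.x v)
    (hl : R.leftClosed u ↔ R.leftClosed v) (hr : R.rightClosed u ↔ R.rightClosed v) : u = v := by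
  by_contra hne
  have huv : G.Adj u v := (R.adj_iff u v hne).2 ⟨.inl (by linarith), .inl (by linarith)⟩
  refine hG u v hne (Set.ext fun z => ?_)
  simp only [closedNbhd, Set.union_singleton, Set.mem_insert_iff, SimpleGraph.mem_neighborSet]
  by_cases hzu : z = u
  · simp [hzu, huv.symm]
  by_cases hzv : z = v
  · simp [hzv, huv]
  simp only [hzu, hzv, false_or]
  rw [R.adj_iff u z (Ne.symm hzu), R.adj_iff v z (Ne.symm hzv), hx, hl, hr]

/-- The three leaves are pairwise at least one apart inside a window of length two around the
centre, so the middle one is at its midpoint. -/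
theorem eq_of_claw (ha : G.Adj p a) (hb : G.Adj p b) (hc : G.Adj p c) (hab : a ≠ b) (hac : a ≠ c)
    (hbc : b ≠ c) (hab' : ¬ G.Adj a b) (hac' : ¬ G.Adj a c) (hbc' : ¬ G.Adj b c) :
    R.x a = R.x p ∨ R.x b = R.x p ∨ R.x c = R.x p := by
  have := R.le_of_adj ha
  have := R.le_of_adj ha.symm
  have := R.le_of_adj hb
  have := R.le_of_adj hb.symm
  have := R.le_of_adj hc
  have := R.le_of_adj hc.symm
  rcases R.one_le_of_not_adj hab hab' with h1 | h1 <;>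
    rcases R.one_le_of_not_adj hac hac' with h2 | h2 <;>
    rcases R.one_le_of_not_adj hbc hbc' with h3 | h3
  · right; left; linarith
  · right; right; linarith
  · exfalso; linarith
  · left; linarith
  · left; linarith
  · exfalso; linarith
  · right; right; linarith
  · right; left; linarith

theorem touch (hsp : G.Adj s p) (hsm : s ≠ m) (hsm' : ¬ G.Adj s m) (hx : R.x m = R.x p) :
    R.x s = R.x p + 1 ∨ R.x s = R.x p - 1 := by
  have := R.le_of_adj hsp
  have := R.le_of_adj hsp.symm
  rcases R.one_le_of_not_adj hsm hsm' with h | h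
  · left; linarith
  · right; linarith

theorem same_side (h : G.Adj s s') {y : ℝ} (h1 : R.x s = y + 1 ∨ R.x s = y - 1)
    (h2 : R.x s' = y + 1 ∨ R.x s' = y - 1) : R.x s = R.x s' := by
  have := R.le_of_adj h
  have := R.le_of_adj h.symm
  rcases h1 with h1 | h1 <;> rcases h2 with h2 | h2 <;> linarith

theorem opposite_side (hne : s ≠ s') (h : ¬ G.Adj s s') {y : ℝ}
    (h1 : R.x s = y + 1 ∨ R.x s = y - 1) (h2 : R.x s' = y + 1 ∨ R.x s' = y - 1) :
    (R.x s = y + 1 ∧ R.x s' = y - 1) ∨ (R.x s = y - 1 ∧ R.x s' = y + 1) := by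
  rcases R.one_le_of_not_adj hne h with h | h <;> rcases h1 with h1 | h1 <;>
    rcases h2 with h2 | h2
  all_goals first
    | exact .inl ⟨h1, h2⟩
    | exact .inr ⟨h1, h2⟩
    | exfalso; linarith

theorem not_three_touch {y : ℝ} (hab : a ≠ b) (hac : a ≠ c) (hbc : b ≠ c)
    (hab' : ¬ G.Adj a b) (hac' : ¬ G.Adj a c) (hbc' : ¬ G.Adj b c)
    (ha : R.x a = y + 1 ∨ R.x a = y - 1) (hb : R.x b = y + 1 ∨ R.x b = y - 1)
    (hc : R.x c = y + 1 ∨ R.x c = y - 1) : False := by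
  rcases R.opposite_side hab hab' ha hb with ⟨h1, h2⟩ | ⟨h1, h2⟩ <;>
    rcases R.opposite_side hac hac' ha hc with ⟨h3, h4⟩ | ⟨h3, h4⟩ <;>
    rcases R.opposite_side hbc hbc' hb hc with ⟨h5, h6⟩ | ⟨h5, h6⟩ <;> linarith

/-- The middle leaf of a claw is represented by an open interval. -/
theorem open_of_middle (ha : G.Adj p a) (hc : G.Adj p c) (hsa : s ≠ a) (hsc : s ≠ c)
    (hac : a ≠ c) (hsa' : ¬ G.Adj s a) (hsc' : ¬ G.Adj s c) (hac' : ¬ G.Adj a c)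
    (hs : R.x s = R.x p) : ¬ R.leftClosed s ∧ ¬ R.rightClosed s := by
  have h1 := R.touch ha.symm hsa.symm (by rwa [G.adj_comm]) hs
  have h2 := R.touch hc.symm hsc.symm (by rwa [G.adj_comm]) hs
  rcases R.opposite_side hac hac' h1 h2 with ⟨h3, h4⟩ | ⟨h3, h4⟩
  · exact ⟨fun hl => hsc' (R.adj_of_closed (by linarith) hl
      (R.closed_of_adj hc (by linarith)).2),
      fun hr => hsa' (R.adj_of_closed (by linarith)
        (R.closed_of_adj ha.symm (by linarith)).1 hr).symm⟩
  · exact ⟨fun hl => hsa' (R.adj_of_closed (by linarith) hl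
      (R.closed_of_adj ha (by linarith)).2),
      fun hr => hsc' (R.adj_of_closed (by linarith)
        (R.closed_of_adj hc.symm (by linarith)).1 hr).symm⟩

/-- The outer leaves are exactly one unit away and meet the centre only in its end points, so these
belong to it. -/
theorem closed_of_middle (ha : G.Adj p a) (hc : G.Adj p c) (hsa : s ≠ a) (hsc : s ≠ c)
    (hac : a ≠ c) (hsa' : ¬ G.Adj s a) (hsc' : ¬ G.Adj s c) (hac' : ¬ G.Adj a c)
    (hs : R.x s = R.x p) : R.leftClosed p ∧ R.rightClosed p := by
  have h1 := R.touch ha.symm hsa.symm (by rwa [G.adj_comm]) hs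
  have h2 := R.touch hc.symm hsc.symm (by rwa [G.adj_comm]) hs
  rcases R.opposite_side hac hac' h1 h2 with ⟨h3, h4⟩ | ⟨h3, h4⟩
  · exact ⟨(R.closed_of_adj hc (by linarith)).1, (R.closed_of_adj ha.symm (by linarith)).2⟩
  · exact ⟨(R.closed_of_adj ha (by linarith)).1, (R.closed_of_adj hc.symm (by linarith)).2⟩

section Strip

variable {k : ℕ} {b t : ℕ → V}

/-- If two vertices are attached to the centre of the initial claw of a strip, then one of the two
initial leaves is the middle one. -/
theorem first_middle (hG : TwinFree G) (h : IsStrip G k b t) (hss : s ≠ s')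
    (hs : G.Adj s (b 1)) (hs' : G.Adj s' (b 1)) (hsb : s ≠ b 0 ∧ ¬ G.Adj s (b 0))
    (hst : s ≠ t 0 ∧ ¬ G.Adj s (t 0)) (hsb' : s' ≠ b 0 ∧ ¬ G.Adj s' (b 0))
    (hst' : s' ≠ t 0 ∧ ¬ G.Adj s' (t 0)) : R.x (b 0) = R.x (b 1) ∨ R.x (t 0) = R.x (b 1) := by
  have hb : G.Adj (b 1) (b 0) := ((h.bb 0 1 (by omega) (by omega)).2 rfl).symm
  have ht : G.Adj (b 1) (t 0) := ((h.tb 0 1 (by omega) (by omega)).2 (by simp)).symm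
  have htb : t 0 ≠ b 0 := h.tb_ne 0 0 (by omega) (by omega)
  have htb' : ¬ G.Adj (t 0) (b 0) := by rw [h.tb 0 0 (by omega) (by omega)]; simp
  -- Otherwise `s` and `s'` are both the middle leaf of a claw at `b 1`, hence open intervals at the
  -- same position, hence twins.
  by_contra! hc
  have key : ∀ z, G.Adj z (b 1) → z ≠ b 0 ∧ ¬ G.Adj z (b 0) → z ≠ t 0 ∧ ¬ G.Adj z (t 0) →
      R.x z = R.x (b 1) := by
    intro z hz hzb hzt
    rcases R.eq_of_claw hz.symm ht hb hzt.1 hzb.1 htb hzt.2 hzb.2 htb' with h | h | h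
    · exact h
    · exact (hc.2 h).elim
    · exact (hc.1 h).elim
  have e := key s hs hsb hst
  have e' := key s' hs' hsb' hst'
  have o := R.open_of_middle ht hb hst.1 hsb.1 htb hst.2 hsb.2 htb' e
  have o' := R.open_of_middle ht hb hst'.1 hsb'.1 htb hst'.2 hsb'.2 htb' e'
  exact hss (R.eq_of_twin hG (e.trans e'.symm) (by simp [o.1, o'.1]) (by simp [o.2, o'.2]))

theorem first_middle_of_pos (hG : TwinFree G) (h : IsStrip G k b t) (hk : 1 ≤ k) :
    R.x (b 0) = R.x (b 1) ∨ R.x (t 0) = R.x (b 1) := by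
  refine R.first_middle hG h (h.tb_ne 1 2 hk (by omega)).symm (s := b 2) (s' := t 1)
    ?_ ?_ ⟨?_, ?_⟩ ⟨?_, ?_⟩ ⟨?_, ?_⟩ ⟨?_, ?_⟩
  · exact ((h.bb 1 2 (by omega) (by omega)).2 rfl).symm
  · rw [h.tb 1 1 hk (by omega)]; simp
  · exact (h.b_ne 0 2 (by omega) (by omega)).symm
  · rw [G.adj_comm, h.bb 0 2 (by omega) (by omega)]; simp
  · exact (h.tb_ne 0 2 (by omega) (by omega)).symm
  · rw [G.adj_comm, h.tb 0 2 (by omega) (by omega)]; simp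
  · exact h.tb_ne 1 0 hk (by omega)
  · rw [h.tb 1 0 hk (by omega)]; simp
  · exact (h.t_ne 0 1 (by omega) hk).symm
  · rw [G.adj_comm]; exact h.tt 0 1 (by omega) hk

/-- Along a strip the lower and the upper vertices have the same position. -/
theorem tight (hG : TwinFree G) (h : IsStrip G k b t) {j : ℕ} (hj : 1 ≤ j) (hjk : j ≤ k) :
    R.x (t j) = R.x (b (j + 1)) ∧
      (R.x (b (j + 1)) = R.x (b j) + 1 ∨ R.x (b (j + 1)) = R.x (b j) - 1) := by
  induction j, hj using Nat.le_induction with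
  | base =>
    have h1 : G.Adj (b 2) (b 1) := ((h.bb 1 2 (by omega) (by omega)).2 rfl).symm
    have h2 : G.Adj (t 1) (b 1) := by rw [h.tb 1 1 hjk (by omega)]; simp
    have h3 : G.Adj (t 1) (b 2) := by rw [h.tb 1 2 hjk (by omega)]; simp
    -- One of the initial leaves sits on `b 1` and is adjacent to neither `b 2` nor `t 1`, so both
    -- must touch `b 1` at an end.
    have key : (R.x (b 2) = R.x (b 1) + 1 ∨ R.x (b 2) = R.x (b 1) - 1) ∧
        (R.x (t 1) = R.x (b 1) + 1 ∨ R.x (t 1) = R.x (b 1) - 1) := by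
      rcases R.first_middle_of_pos hG h hjk with e | e
      · refine ⟨R.touch h1 (h.b_ne 0 2 (by omega) (by omega)).symm ?_ e,
          R.touch h2 (h.tb_ne 1 0 hjk (by omega)) ?_ e⟩
        · rw [G.adj_comm, h.bb 0 2 (by omega) (by omega)]; simp
        · rw [h.tb 1 0 hjk (by omega)]; simp
      · refine ⟨R.touch h1 (h.tb_ne 0 2 (by omega) (by omega)).symm ?_ e,
          R.touch h2 (h.t_ne 0 1 (by omega) hjk).symm ?_ e⟩
        · rw [G.adj_comm, h.tb 0 2 (by omega) (by omega)]; simp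
        · rw [G.adj_comm]; exact h.tt 0 1 (by omega) hjk
    exact ⟨R.same_side h3 key.2 key.1, key.1⟩
  | succ j hj ih =>
    have e := (ih (by omega)).1
    have h1 : G.Adj (b (j + 2)) (b (j + 1)) :=
      ((h.bb (j + 1) (j + 2) (by omega) (by omega)).2 rfl).symm
    have h2 : G.Adj (t (j + 1)) (b (j + 1)) := by
      rw [h.tb (j + 1) (j + 1) hjk (by omega)]; simp
    have h3 : G.Adj (t (j + 1)) (b (j + 2)) := by
      rw [h.tb (j + 1) (j + 2) hjk (by omega)]; simp
    have h4 := R.touch h1 (h.tb_ne j (j + 2) (by omega) (by omega)).symm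
      (by rw [G.adj_comm, h.tb j (j + 2) (by omega) (by omega)]; omega) e
    have h5 := R.touch h2 (h.t_ne j (j + 1) (by omega) hjk).symm
      (by rw [G.adj_comm]; exact h.tt j (j + 1) (by omega) hjk) e
    exact ⟨R.same_side h3 h5 h4, h4⟩

/-- Some leaf sits on `b (k + 1)`, so the two pendants and one further neighbour, pairwise
independent, all touch it at an end; there are only two sides. -/
theorem not_two_isPendant (R : UnitRep G) (hG : TwinFree G) (h : IsStrip G k b t) (hs : IsPendant G k b t s)
    (hs' : IsPendant G k b t s') (hne : s ≠ s') (hss : ¬ G.Adj s s') : False := by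
  rcases Nat.eq_zero_or_pos k with rfl | hk
  · have hb : G.Adj (b 0) (b 1) := (h.bb 0 1 (by omega) (by omega)).2 rfl
    have ht : G.Adj (t 0) (b 1) := (h.tb 0 1 (by omega) (by omega)).2 (by simp)
    have htb : t 0 ≠ b 0 := h.tb_ne 0 0 (by omega) (by omega)
    have htb' : ¬ G.Adj (t 0) (b 0) := by rw [h.tb 0 0 (by omega) (by omega)]; simp
    have n1 := hs.b_ne 0 le_rfl
    have n2 := hs.b_not_adj 0 le_rfl
    have n3 := hs.t_ne 0 le_rfl
    have n4 := hs.t_not_adj 0 le_rfl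
    have n1' := hs'.b_ne 0 le_rfl
    have n2' := hs'.b_not_adj 0 le_rfl
    have n3' := hs'.t_ne 0 le_rfl
    have n4' := hs'.t_not_adj 0 le_rfl
    rcases R.first_middle hG h hne hs.adj hs'.adj ⟨n1, n2⟩ ⟨n3, n4⟩ ⟨n1', n2'⟩ ⟨n3', n4'⟩
      with e | e
    · exact R.not_three_touch hne n3 n3' hss n4 n4' (R.touch hs.adj n1 n2 e)
        (R.touch hs'.adj n1' n2' e) (R.touch ht htb htb' e)
    · exact R.not_three_touch hne n1 n1' hss n2 n2' (R.touch hs.adj n3 n4 e)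
        (R.touch hs'.adj n3' n4' e) (R.touch hb htb.symm (by rwa [G.adj_comm]) e)
  · obtain ⟨e, e'⟩ := R.tight hG h hk le_rfl
    refine R.not_three_touch hne (hs.b_ne k le_rfl) (hs'.b_ne k le_rfl) hss
      (hs.b_not_adj k le_rfl) (hs'.b_not_adj k le_rfl)
      (R.touch hs.adj (hs.t_ne k le_rfl) (hs.t_not_adj k le_rfl) e)
      (R.touch hs'.adj (hs'.t_ne k le_rfl) (hs'.t_not_adj k le_rfl) e) ?_
    rcases e' with e' | e'
    · right; linarith
    · left; linarith

/-- The vertex `s` must touch `t (k + 1)` on the side of `b (k + 1)`, with a closed end. At the same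
point `b (k + 2)` has a closed end, because it touches `b (k + 1)` there, so `s` meets it as well.
-/
theorem not_linked (R : UnitRep G) (hG : TwinFree G) (h : IsStrip G (k + 1) b t) (hb : G.Adj s (b (k + 1)))
    (ht : G.Adj s (t (k + 1))) (hne : s ≠ b (k + 2)) (hs : ¬ G.Adj s (b (k + 2))) : False := by
  obtain ⟨e, e'⟩ := R.tight hG h (j := k + 1) (by omega) le_rfl
  have hbb : G.Adj (b (k + 1)) (b (k + 2)) := (h.bb _ _ (by omega) le_rfl).2 rfl
  have l1 := R.le_of_adj hb
  have l2 := R.le_of_adj hb.symm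
  have l3 := R.le_of_adj ht
  have l4 := R.le_of_adj ht.symm
  rcases e' with e' | e' <;> rcases R.one_le_of_not_adj hne hs with h' | h'
  · linarith
  · exact hs (R.adj_of_closed (by linarith) (R.closed_of_adj hbb.symm e').1
      (R.closed_of_adj ht.symm (by linarith)).2).symm
  · exact hs (R.adj_of_closed (by linarith) (R.closed_of_adj ht (by linarith)).1
      (R.closed_of_adj hbb (by linarith)).2)
  · linarith

/-- The vertices `s`, `t (k + 1)` and `b (k + 2)` share a position and are all closed towards `b (k
+ 1)`. Only the other end can distinguish them, so two of the three are twins. -/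
theorem not_triangle (R : UnitRep G) (hG : TwinFree G) (h : IsStrip G (k + 1) b t) (hb : G.Adj s (b (k + 1)))
    (hb' : G.Adj s (b (k + 2))) (ht : G.Adj s (t (k + 1)))
    (hsb : ∀ j ≤ k, s ≠ b j ∧ ¬ G.Adj s (b j)) (hst : ∀ j ≤ k, s ≠ t j ∧ ¬ G.Adj s (t j)) :
    False := by
  obtain ⟨e, e'⟩ := R.tight hG h (j := k + 1) (by omega) le_rfl
  have hbb : G.Adj (b (k + 1)) (b (k + 2)) := (h.bb _ _ (by omega) le_rfl).2 rfl
  have htb : G.Adj (t (k + 1)) (b (k + 1)) := by rw [h.tb _ _ le_rfl (by omega)]; simp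
  have htb' : G.Adj (t (k + 1)) (b (k + 2)) := by rw [h.tb _ _ le_rfl (by omega)]; simp
  have hs : R.x s = R.x (b (k + 1)) + 1 ∨ R.x s = R.x (b (k + 1)) - 1 := by
    rcases Nat.eq_zero_or_pos k with rfl | hk
    · rcases R.first_middle_of_pos hG h le_rfl with e | e
      · exact R.touch hb (hsb 0 le_rfl).1 (hsb 0 le_rfl).2 e
      · exact R.touch hb (hst 0 le_rfl).1 (hst 0 le_rfl).2 e
    · exact R.touch hb (hst k le_rfl).1 (hst k le_rfl).2 (R.tight hG h hk (by omega)).1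
  have hx := R.same_side hb' hs e'
  have key : ∀ y z, R.x y = R.x (b (k + 2)) → R.x z = R.x (b (k + 2)) → y ≠ z → ((R.leftClosed y ↔ R.leftClosed z) ∧
        (R.rightClosed y ↔ R.rightClosed z) → False) := fun y z hy hz hne hc =>
    hne (R.eq_of_twin hG (hy.trans hz.symm) hc.1 hc.2)
  have k1 := key s (t (k + 1)) hx e ht.ne
  have k2 := key s (b (k + 2)) hx rfl hb'.ne
  have k3 := key (t (k + 1)) (b (k + 2)) e rfl htb'.ne
  rcases e' with e' | e'
  · have c1 := (R.closed_of_adj hb (by linarith)).1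
    have c2 := (R.closed_of_adj htb (by linarith)).1
    have c3 := (R.closed_of_adj hbb.symm (by linarith)).1
    tauto
  · have c1 := (R.closed_of_adj hb.symm (by linarith)).2
    have c2 := (R.closed_of_adj htb.symm (by linarith)).2
    have c3 := (R.closed_of_adj hbb (by linarith)).2
    tauto

end Strip

/-- The possible middle vertices of the claw `p; o, m, w`, when `v` is adjacent to `p`, `m`, `w`
only. -/
theorem middle_of_linked_claw (ho : G.Adj p o) (hm : G.Adj p m) (hw : G.Adj p w) (hv : G.Adj v p)
    (hvm : G.Adj v m) (hvw : G.Adj v w) (hvo : v ≠ o) (hvo' : ¬ G.Adj v o)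
    (hom : o ≠ m) (how : o ≠ w) (hmw : m ≠ w) (hom' : ¬ G.Adj o m) (how' : ¬ G.Adj o w)
    (hmw' : ¬ G.Adj m w) : R.x m = R.x p ∨ R.x w = R.x p := by
  rcases R.eq_of_claw ho hm hw hom how hmw hom' how' hmw' with e | e | e
  · exfalso
    have h1 := R.touch hv hvo hvo' e
    have h2 := R.touch hm.symm hom.symm (by rwa [G.adj_comm]) e
    have h3 := R.touch hw.symm how.symm (by rwa [G.adj_comm]) e
    have h4 := R.same_side hvm h1 h2
    have h5 := R.same_side hvw h1 h3
    rcases R.opposite_side hmw hmw' h2 h3 with h | h <;> linarith [h.1, h.2]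
  · exact .inl e
  · exact .inr e

theorem not_two_strips (R : UnitRep G) (hG : TwinFree G) {i j : ℕ} {b t b' t' : ℕ → V}
    (h : IsStrip G i b t) (h' : IsStrip G j b' t')
    (hbb : G.Adj (b (i + 1)) (b' (j + 1))) (hbt : G.Adj (b (i + 1)) (t' j))
    (htb : G.Adj (t i) (b' (j + 1))) (htt : t i ≠ t' j) (htt' : ¬ G.Adj (t i) (t' j))
    (hb : ∀ z, z = b' j ∨ z = b' (j + 1) ∨ z = t' j → b i ≠ z ∧ ¬ G.Adj (b i) z)
    (hb' : ∀ z, z = b i ∨ z = b (i + 1) ∨ z = t i → b' j ≠ z ∧ ¬ G.Adj (b' j) z) : False := by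
  have a1 : G.Adj (b i) (b (i + 1)) := (h.bb _ _ (by omega) le_rfl).2 rfl
  have a1' : G.Adj (b' j) (b' (j + 1)) := (h'.bb _ _ (by omega) le_rfl).2 rfl
  have a2 : G.Adj (t i) (b (i + 1)) := by rw [h.tb _ _ le_rfl (by omega)]; simp
  have a2' : G.Adj (t' j) (b' (j + 1)) := by rw [h'.tb _ _ le_rfl (by omega)]; simp
  have hti := h.tb_ne i i le_rfl (by omega)
  have htj := h'.tb_ne j j le_rfl (by omega)
  have o1 := hb (b' j) (by simp)
  have o2 := hb (b' (j + 1)) (by simp)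
  have o3 := hb (t' j) (by simp)
  have o2' := hb' (b (i + 1)) (by simp)
  have o3' := hb' (t i) (by simp)
  have middle : R.x (t i) = R.x (b (i + 1)) ∨ R.x (t' j) = R.x (b (i + 1)) ∧ i = 0 := by
    rcases Nat.eq_zero_or_pos i with rfl | hi
    · have ht0 : ¬ G.Adj (b 0) (t 0) := by rw [G.adj_comm, h.tb _ _ le_rfl (by omega)]; simp
      have := R.middle_of_linked_claw a1.symm a2.symm hbt hbb.symm htb.symm a2'.symm
        o2.1.symm (by rw [G.adj_comm]; exact o2.2) hti.symm o3.1 htt ht0 o3.2 htt'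
      simpa using this
    · exact .inl (R.tight hG h hi le_rfl).1
  have middle' : R.x (t' j) = R.x (b' (j + 1)) ∨ R.x (t i) = R.x (b' (j + 1)) ∧ j = 0 := by
    rcases Nat.eq_zero_or_pos j with rfl | hj
    · have ht0 : ¬ G.Adj (b' 0) (t' 0) := by
        rw [G.adj_comm, h'.tb _ _ le_rfl (by omega)]; simp
      have := R.middle_of_linked_claw a1'.symm a2'.symm htb.symm hbb hbt a2.symm
        o2'.1.symm (by rw [G.adj_comm]; exact o2'.2) htj.symm o3'.1 htt.symm ht0 o3'.2
        (by rwa [G.adj_comm])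
      simpa using this
    · exact .inl (R.tight hG h' hj le_rfl).1
  -- If `w` sits on both `p` and `v`, the independent vertices `m`, `o`, `q` all touch that one
  -- position, which has only two sides.
  have separate : ∀ {p m o w q v : V}, G.Adj m p → G.Adj o p → G.Adj q v → m ≠ w → ¬ G.Adj m w →
      o ≠ w → ¬ G.Adj o w → q ≠ p → ¬ G.Adj q p → m ≠ o → ¬ G.Adj m o → q ≠ m → ¬ G.Adj q m →
      o ≠ q → ¬ G.Adj o q → R.x w = R.x p → R.x w = R.x v → False := by
    intro p m o w q v hm ho hq n1 n1' n2 n2' n3 n3' n4 n4' n5 n5' n6 n6' e e'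
    have hq' := R.touch hq n3 n3' (by linarith)
    rw [← e', e] at hq'
    exact R.not_three_touch n4 n5.symm n6 n4' (by rwa [G.adj_comm]) n6'
      (R.touch hm n1 n1' e) (R.touch ho n2 n2' e) hq'
  -- When each upper vertex sits on its own lower one, or each on the other's, the prescribed
  -- adjacencies force facing closed ends of `t i` and `t' j` to meet. In the mixed cases one upper
  -- vertex sits on both lower ones, and `separate` applies.
  rcases middle with e | ⟨e, rfl⟩ <;> rcases middle' with e' | ⟨e', rfl⟩
  · rcases R.touch htb htt htt' e' with h1 | h1
    · exact htt' (R.adj_of_closed (by linarith) (R.closed_of_adj htb (by linarith)).1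
        (R.closed_of_adj hbt (by linarith)).2)
    · exact htt' (R.adj_of_closed (by linarith) (R.closed_of_adj hbt.symm (by linarith)).1
        (R.closed_of_adj htb.symm (by linarith)).2).symm
  · have ht0 : ¬ G.Adj (t' 0) (b' 0) := by rw [h'.tb _ _ le_rfl (by omega)]; simp
    exact separate a2' a1' a1 htt.symm (by rwa [G.adj_comm]) o3'.1 o3'.2 o2.1 o2.2 htj ht0
      o3.1 o3.2 o1.1.symm (by rw [G.adj_comm]; exact o1.2) e' e
  · have ht0 : ¬ G.Adj (t 0) (b 0) := by rw [h.tb _ _ le_rfl (by omega)]; simp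
    exact separate a2 a1 a1' htt htt' o3.1 o3.2 o2'.1 o2'.2 hti ht0
      o3'.1 o3'.2 o1.1 o1.2 e e'
  · rcases R.touch a2 htt htt' e with h1 | h1
    · exact htt' (R.adj_of_closed (by linarith) (R.closed_of_adj a2 (by linarith)).1
        (R.closed_of_adj a2'.symm (by linarith)).2)
    · exact htt' (R.adj_of_closed (by linarith) (R.closed_of_adj a2' (by linarith)).1
        (R.closed_of_adj a2.symm (by linarith)).2).symm

/-- The outer leaves determine the position of a centre, and both centres are closed at both ends;
so they are twins. -/
theorem not_two_centers (R : UnitRep G) (hG : TwinFree G) {p q a u c : V}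
    (hpq : p ≠ q) (hpa : G.Adj p a) (hpu : G.Adj p u) (hpc : G.Adj p c)
    (hqa : G.Adj q a) (hqu : G.Adj q u) (hqc : G.Adj q c)
    (hau : a ≠ u) (hac : a ≠ c) (huc : u ≠ c)
    (hau' : ¬ G.Adj a u) (hac' : ¬ G.Adj a c) (huc' : ¬ G.Adj u c) : False := by
  have main : ∀ {a u c : V}, G.Adj p a → G.Adj p c → G.Adj p u → G.Adj q a → G.Adj q c →
      G.Adj q u → u ≠ a → u ≠ c → a ≠ c →
      ¬ G.Adj u a → ¬ G.Adj u c → ¬ G.Adj a c → R.x u = R.x p → False := by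
    intro a u c hpa hpc hpu hqa hqc hqu n1 n2 n3 n1' n2' n3' e
    have h1 := R.touch hpa.symm n1.symm (by rwa [G.adj_comm]) e
    have h2 := R.touch hpc.symm n2.symm (by rwa [G.adj_comm]) e
    have e' : R.x p = R.x q := by
      have := R.le_of_adj hqa
      have := R.le_of_adj hqa.symm
      have := R.le_of_adj hqc
      have := R.le_of_adj hqc.symm
      rcases R.opposite_side n3 n3' h1 h2 with h | h <;> linarith [h.1, h.2]
    have c1 := R.closed_of_middle hpa hpc n1 n2 n3 n1' n2' n3' e
    have c2 := R.closed_of_middle hqa hqc n1 n2 n3 n1' n2' n3' (e.trans e')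
    exact hpq (R.eq_of_twin hG e' (by simp [c1.1, c2.1]) (by simp [c1.2, c2.2]))
  have hau'' : ¬ G.Adj u a := by rwa [G.adj_comm]
  have hac'' : ¬ G.Adj c a := by rwa [G.adj_comm]
  have huc'' : ¬ G.Adj c u := by rwa [G.adj_comm]
  rcases R.eq_of_claw hpa hpu hpc hau hac huc hau' hac' huc' with e | e | e
  · exact main hpu hpc hpa hqu hqc hqa hau hac huc hau' hac' huc' e
  · exact main hpa hpc hpu hqa hqc hqu hau.symm huc hac hau'' huc' hac' e
  · exact main hpa hpu hpc hqa hqu hqc hac.symm huc.symm hau hac'' huc'' hau' e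

/-- Mixed unit interval graphs without twins contain none of the forbidden graphs. -/
theorem familyFree (R : UnitRep G) (hG : TwinFree G) : FamilyFree forbidden G := by
  rintro H ((((rfl | ⟨k, rfl⟩) | ⟨k, rfl⟩) | ⟨k, rfl⟩) | ⟨i, j, -, rfl⟩) ⟨φ⟩
  · have hne : ∀ x y, x ≠ y → φ x ≠ φ y := fun x y h => φ.injective.ne h
    have hadj : ∀ i j, G.Adj (φ (.inl i)) (φ (.inr j)) := fun i j =>
      φ.map_adj_iff.2 graphK23_adj_inl_inr
    have hnot : ∀ i j, ¬ G.Adj (φ (.inr i)) (φ (.inr j)) := fun i j h =>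
      graphK23_not_adj_inr_inr (φ.map_adj_iff.1 h)
    exact R.not_two_centers hG (hne (.inl 0) (.inl 1) (by simp)) (hadj 0 0) (hadj 0 1)
      (hadj 0 2) (hadj 1 0) (hadj 1 1) (hadj 1 2) (hne _ _ (by simp)) (hne _ _ (by simp))
      (hne _ _ (by simp)) (hnot _ _) (hnot _ _) (hnot _ _)
  · have h := IsStrip.of_embedding
      (((someEmbedding (graphQ k) {specialV k}).trans (someEmbedding _ _)).trans φ)
    have pend : ∀ (x : Option (Option (VertQ k))), (∀ y : VertQ k, x ≠ some (some y) ∧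
        ((graphR k).Adj x (some (some y)) ↔ y = specialV k)) →
        IsPendant G k (fun j => φ (some (some (.inl (Fin.ofNat (k + 2) j)))))
          (fun j => φ (some (some (.inr (Fin.ofNat (k + 1) j))))) (φ x) := fun x hx => by
      have hlt : ∀ j ≤ k, (.inl (Fin.ofNat (k + 2) j) : VertQ k) ≠ specialV k := fun j hj => by
        simp only [specialV, ne_eq, Sum.inl.injEq, Fin.ext_iff, Fin.val_ofNat, Fin.val_last]
        rw [Nat.mod_eq_of_lt (by omega)]; omega
      exact
      { adj := φ.map_adj_iff.2 (((hx _).2).2 (by simp [specialV]))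
        b_ne := fun j _ => φ.injective.ne (hx _).1
        b_not_adj := fun j hj h => hlt j hj ((hx _).2.1 (φ.map_adj_iff.1 h))
        t_ne := fun j _ => φ.injective.ne (hx _).1
        t_not_adj := fun j _ h => by
          have := (hx _).2.1 (φ.map_adj_iff.1 h)
          simp [specialV] at this }
    refine R.not_two_isPendant hG h (pend (some none) fun y => ⟨by simp, ?_⟩)
      (pend none fun y => ⟨by simp, ?_⟩) (φ.injective.ne (by simp)) ?_
    · exact addVertex_adj_some_some.trans addVertex_adj_none_some
    · exact addVertex_adj_none_some.trans (by simp)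
    · rw [φ.map_adj_iff, SimpleGraph.adj_comm]
      exact fun h => by simpa using addVertex_adj_none_some.1 h
  · have h := IsStrip.of_embedding ((someEmbedding (graphQ (k + 1)) _).trans φ)
    have hs : ∀ y, G.Adj (φ none) (φ (some y)) ↔ y ∈ _ := fun y =>
      φ.map_adj_iff.trans addVertex_adj_none_some
    refine R.not_linked hG h (s := φ none) ((hs _).2 ?_) ((hs _).2 ?_)
      (φ.injective.ne (Option.some_ne_none _).symm) (fun h => ?_)
    · simp [hubQ, specialW, Fin.ext_iff, Nat.mod_eq_of_lt]
    · simp [hubQ, specialW, Fin.ext_iff]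
    · have := (hs _).1 h
      simp [hubQ, specialW, Fin.ext_iff] at this
  · have h := IsStrip.of_embedding ((someEmbedding (graphQ (k + 1)) _).trans φ)
    have hs : ∀ y, G.Adj (φ none) (φ (some y)) ↔ y ∈ _ := fun y =>
      φ.map_adj_iff.trans addVertex_adj_none_some
    refine R.not_triangle hG h (s := φ none) ((hs _).2 ?_) ((hs _).2 ?_) ((hs _).2 ?_)
      (fun j hj => ⟨φ.injective.ne (Option.some_ne_none _).symm, fun h => ?_⟩)
      (fun j hj => ⟨φ.injective.ne (Option.some_ne_none _).symm, fun h => ?_⟩)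
    · simp [hubQ, specialV, specialW, Fin.ext_iff, Nat.mod_eq_of_lt]
    · simp [hubQ, specialV, specialW]
    · simp [hubQ, specialV, specialW]
    · have := (hs _).1 h
      simp only [specialV, specialW, hubQ, Set.mem_insert_iff, Set.mem_singleton_iff,
        Sum.inl.injEq, Fin.ext_iff, Fin.val_ofNat, Fin.val_last, Fin.val_castSucc,
        reduceCtorEq, false_or] at this
      rw [Nat.mod_eq_of_lt (by omega)] at this
      omega
    · have := (hs _).1 h
      simp only [specialV, specialW, hubQ, Set.mem_insert_iff, Set.mem_singleton_iff,
        Sum.inr.injEq, Fin.ext_iff, Fin.val_ofNat, Fin.val_last,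
        reduceCtorEq, false_or, or_false] at this
      rw [Nat.mod_eq_of_lt (by omega)] at this
      omega
  · have h := IsStrip.of_embedding ((inlEmbedding i j).trans φ)
    have h' := IsStrip.of_embedding ((inrEmbedding i j).trans φ)
    have hs : ∀ x y, G.Adj (φ (.inl x)) (φ (.inr y)) ↔ _ := fun x y =>
      φ.map_adj_iff.trans graphT_adj_inl_inr
    refine R.not_two_strips hG h h' ((hs _ _).2 ?_) ((hs _ _).2 ?_) ((hs _ _).2 ?_)
      (φ.injective.ne (by simp [inlEmbedding, inrEmbedding])) (fun h => ?_) ?_ ?_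
    · simp [specialV, specialW]
    · simp [specialV, specialW]
    · simp [specialV, specialW]
    · have := (hs _ _).1 h
      simp [specialV, specialW] at this
    · have key : ∀ y : VertQ j, φ (.inl (.inl (Fin.ofNat (i + 2) i))) ≠ φ (.inr y) ∧
          ¬ G.Adj (φ (.inl (.inl (Fin.ofNat (i + 2) i)))) (φ (.inr y)) := fun y => by
        refine ⟨φ.injective.ne (by simp), fun h => ?_⟩
        have := (hs _ _).1 h
        simp [specialV, specialW, Fin.ext_iff, Nat.mod_eq_of_lt] at this
      rintro z (rfl | rfl | rfl) <;> exact key _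
    · have key : ∀ y : VertQ i, φ (.inr (.inl (Fin.ofNat (j + 2) j))) ≠ φ (.inl y) ∧
          ¬ G.Adj (φ (.inr (.inl (Fin.ofNat (j + 2) j)))) (φ (.inl y)) := fun y => by
        refine ⟨φ.injective.ne (by simp), fun h => ?_⟩
        have := (hs _ _).1 h.symm
        simp [specialV, specialW, Fin.ext_iff, Nat.mod_eq_of_lt] at this
      rintro z (rfl | rfl | rfl) <;> exact key _

end UnitRep

/-! ### Clique models of interval graphs -/

/-- An interval representation on the line of maximal cliques: every vertex `v` occupies the
integers from `l v` to `r v`, distinct vertices occupy distinct intervals, and any two consecutive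
integers in the relevant range are separated by a left end point and by a right end point. -/
structure CliqueModel (G : SimpleGraph V) where
  l : V → ℤ
  r : V → ℤ
  le : ∀ v, l v ≤ r v
  adj_iff : ∀ u v, u ≠ v → (G.Adj u v ↔ l u ≤ r v ∧ l v ≤ r u)
  eq_of_eq : ∀ u v, l u = l v → r u = r v → u = v
  exists_right : ∀ u v i, l u ≤ i → i < l v → ∃ s, r s = i
  exists_left : ∀ u v i, r u < i → i ≤ r v → ∃ s, l s = i

/-- Order-connected sets are disjoint only if one lies entirely before the other; this reduces
intervals to the order "entirely to the left of". -/
theorem inter_nonempty_iff {A B : Set ℝ} (hA : A ∈ intervals) (hB : B ∈ intervals) :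
    (A ∩ B).Nonempty ↔ (¬ ∀ a ∈ A, ∀ b ∈ B, a < b) ∧ ¬ ∀ b ∈ B, ∀ a ∈ A, b < a := by
  have ord : ∀ {A : Set ℝ}, A ∈ intervals → A.OrdConnected := by
    rintro A ⟨-, a, b, rfl | rfl | rfl | rfl⟩
    · exact Set.ordConnected_Icc
    · exact Set.ordConnected_Ioo
    · exact Set.ordConnected_Ioc
    · exact Set.ordConnected_Ico
  constructor
  · rintro ⟨z, hA, hB⟩
    exact ⟨fun h => (h z hA z hB).false, fun h => (h z hB z hA).false⟩
  · rintro ⟨h1, h2⟩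
    push Not at h1 h2
    obtain ⟨a, ha, b, hb, hba⟩ := h1
    obtain ⟨d, hd, c, hc, hcd⟩ := h2
    rcases le_total a d with h | h
    · exact ⟨a, ha, (ord hB).out hb hd ⟨hba, h⟩⟩
    · exact ⟨d, (ord hA).out hc ha ⟨hcd, h⟩, hd⟩

/-- In an interval order the predecessor sets form a chain. The left end of `v` is the rank of its
predecessor set; its right end is the largest rank of a vertex that `v` does not precede. Every rank
is attained and consecutive predecessor sets differ, which gives the two separation properties;
twin-freeness gives distinctness. -/
theorem exists_cliqueModel [Finite V] (hG : TwinFree G) (hI : IsIntervalGraph G) :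
    Nonempty (CliqueModel G) := by
  classical
  have := Fintype.ofFinite V
  obtain ⟨f, hf, hadj⟩ := hI
  set lt : V → V → Prop := fun u v => ∀ a ∈ f u, ∀ b ∈ f v, a < b with hlt
  have irrefl : ∀ v, ¬ lt v v := fun v h => by
    obtain ⟨a, ha⟩ := (hf v).1
    exact (h a ha a ha).false
  have chain : ∀ {u v w z : V}, lt u v → lt w z → ¬ lt u z → lt w v := by
    intro u v w z huv hwz huz a ha b hb
    simp only [hlt] at huz
    push Not at huz
    obtain ⟨x, hx, y, hy, hyx⟩ := huz
    exact ((hwz a ha y hy).trans_le hyx).trans (huv x hx b hb)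
  set g : V → ℕ := fun v => (Finset.univ.filter fun u => lt u v).card with hg
  have g_lt : ∀ {v w z}, lt v w → ¬ lt v z → g z < g w := by
    intro v w z hw hz
    refine Finset.card_lt_card (Finset.ssubset_iff_of_subset ?_ |>.2 ⟨v, ?_, ?_⟩)
    · intro u hu
      simp only [Finset.mem_filter, Finset.mem_univ, true_and] at hu ⊢
      exact chain hw hu hz
    · simpa using hw
    · simpa using hz
  have exists_of_g_lt : ∀ {z w}, g z < g w → ∃ v, lt v w ∧ ¬ lt v z := by
    intro z w h
    by_contra! hc
    exact h.not_ge (Finset.card_le_card fun u hu => by simpa using hc u (by simpa using hu))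
  set S : Finset ℕ := Finset.univ.image g
  have memS : ∀ v, g v ∈ S := fun v => Finset.mem_image_of_mem _ (Finset.mem_univ v)
  set e := S.orderIsoOfFin rfl
  set L : V → ℕ := fun v => (e.symm ⟨g v, memS v⟩ : Fin _) with hL
  have L_lt : ∀ {v w}, L v < L w ↔ g v < g w := fun {v w} => by
    simp only [hL, ← Fin.lt_def, e.symm.lt_iff_lt]
    rfl
  have exists_L : ∀ {v i}, i ≤ L v → ∃ w, L w = i := by
    intro v i hi
    have hi' : i < S.card := hi.trans_lt (e.symm ⟨g v, memS v⟩).2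
    obtain ⟨w, -, hw⟩ := Finset.mem_image.1 (e ⟨i, hi'⟩).2
    refine ⟨w, ?_⟩
    have : (⟨g w, memS w⟩ : S) = e ⟨i, hi'⟩ := Subtype.ext hw
    simp [hL, this]
  have exists_max : ∀ v, ∃ w, ¬ lt v w ∧ ∀ z, ¬ lt v z → L z ≤ L w := fun v => by
    obtain ⟨w, hw, h⟩ := Finset.exists_max_image (Finset.univ.filter fun w => ¬ lt v w) L
      ⟨v, by simpa using irrefl v⟩
    exact ⟨w, by simpa using hw, fun z hz => h z (by simpa using hz)⟩
  choose m hm hmax using exists_max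
  have lt_iff : ∀ v w, lt v w ↔ L (m v) < L w := fun v w =>
    ⟨fun h => L_lt.2 (g_lt h (hm v)), fun h => by
      by_contra hc
      exact h.not_ge (hmax v w hc)⟩
  have adj : ∀ u v, u ≠ v → (G.Adj u v ↔ L u ≤ L (m v) ∧ L v ≤ L (m u)) := fun u v huv => by
    rw [hadj u v huv, inter_nonempty_iff (hf u) (hf v)]
    have h1 := lt_iff u v
    have h2 := lt_iff v u
    simp only [hlt] at h1 h2
    rw [h1, h2, not_lt, not_lt, and_comm]
  have le : ∀ v, L v ≤ L (m v) := fun v => hmax v v (irrefl v)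
  refine ⟨⟨fun v => L v, fun v => L (m v), fun v => by exact_mod_cast le v,
    fun u v huv => by rw [adj u v huv]; norm_cast, fun u v hl hr => ?_, fun u v i hu hv => ?_,
    fun u v i hu hv => ?_⟩⟩
  · by_contra hne
    norm_cast at hl hr
    refine hG u v hne (Set.ext fun z => ?_)
    have huv : G.Adj u v := (adj u v hne).2 ⟨by rw [← hr]; exact le u, by rw [hr]; exact le v⟩
    simp only [closedNbhd, Set.union_singleton, Set.mem_insert_iff, SimpleGraph.mem_neighborSet]
    by_cases hzu : z = u
    · simp [hzu, huv.symm]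
    by_cases hzv : z = v
    · simp [hzv, huv]
    rw [adj u z (Ne.symm hzu), adj v z (Ne.symm hzv), hl, hr]
    simp [hzu, hzv]
  · lift i to ℕ using by omega
    norm_cast at hu hv
    obtain ⟨z, hz⟩ := exists_L hv.le
    obtain ⟨w, hw⟩ := exists_L (Nat.succ_le_of_lt hv)
    -- A vertex preceding rank `i + 1` but not rank `i` has right end exactly `i`.
    obtain ⟨s, hsw, hsz⟩ := exists_of_g_lt (L_lt.1 (show L z < L w by omega))
    refine ⟨s, ?_⟩
    have h1 := (lt_iff s w).1 hsw
    rw [lt_iff s z] at hsz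
    norm_cast
    omega
  · lift i to ℕ using by omega
    norm_cast at hv
    obtain ⟨s, hs⟩ := exists_L hv
    exact ⟨s, by exact_mod_cast hs⟩

namespace CliqueModel

/-- The mirror image of a clique model. -/
def flip (M : CliqueModel G) : CliqueModel G where
  l v := -M.r v
  r v := -M.l v
  le v := neg_le_neg (M.le v)
  adj_iff u v huv := by
    rw [M.adj_iff u v huv, neg_le_neg_iff, neg_le_neg_iff, and_comm]
  eq_of_eq u v hl hr := M.eq_of_eq u v (neg_injective hr) (neg_injective hl)
  exists_right u v i hu hv := by
    obtain ⟨s, hs⟩ := M.exists_left v u (-i) (by omega) (by omega)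
    exact ⟨s, by omega⟩
  exists_left u v i hu hv := by
    obtain ⟨s, hs⟩ := M.exists_right v u (-i) (by omega) (by omega)
    exact ⟨s, by omega⟩

variable (M : CliqueModel G) {k k' : ℕ} {b t b' t' : ℕ → V} {p q s s' u v w : V}

@[simp] theorem flip_l (v : V) : M.flip.l v = -M.r v := rfl

@[simp] theorem flip_r (v : V) : M.flip.r v = -M.l v := rfl

theorem flip_flip : M.flip.flip = M := by simp [flip]

theorem adj_of (hne : u ≠ v) (h1 : M.l u ≤ M.r v) (h2 : M.l v ≤ M.r u) : G.Adj u v :=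
  (M.adj_iff u v hne).2 ⟨h1, h2⟩

theorem ne_and_not_adj (h : M.r u < M.l v) : u ≠ v ∧ ¬ G.Adj u v := by
  have hne : u ≠ v := by
    rintro rfl
    have := M.le u
    omega
  refine ⟨hne, fun hadj => ?_⟩
  have := ((M.adj_iff u v hne).1 hadj).2
  omega

theorem le_of_adj (h : G.Adj u v) : M.l u ≤ M.r v := ((M.adj_iff u v h.ne).1 h).1

/-! ### Forced coincidences of end points and the strips behind them -/

/-- No interval lies in the interior of two different intervals. -/
theorem eq_of_inside (hG : FamilyFree forbidden G) (hp : M.l p < M.l u) (hp' : M.r u < M.r p)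
    (hq : M.l q < M.l u) (hq' : M.r u < M.r q) : p = q := by
  by_contra hne
  -- The intervals just before and just after `u` are the other two leaves of a `K_{2,3}^*` with
  -- centres `p` and `q`.
  obtain ⟨a, ha⟩ := M.exists_right p u (M.l u - 1) (by omega) (by omega)
  obtain ⟨c, hc⟩ := M.exists_left u p (M.r u + 1) (by omega) (by omega)
  have hu := M.le u
  have ha' := M.le a
  have hc' := M.le c
  have adj : ∀ {x}, M.l x < M.l u → M.r u < M.r x → ∀ y, M.l y ≤ M.r u + 1 → M.l u - 1 ≤ M.r y →
      (M.r y ≤ M.r u ∨ M.l u ≤ M.l y) → G.Adj x y := by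
    intro x h1 h2 y h3 h4 h5
    refine M.adj_of ?_ (by omega) (by omega)
    rintro rfl
    omega
  have n1 := M.ne_and_not_adj (u := a) (v := u) (by omega)
  have n2 := M.ne_and_not_adj (u := a) (v := c) (by omega)
  have n3 := M.ne_and_not_adj (u := u) (v := c) (by omega)
  exact hG.not_two_centers (M.adj_of hne (by omega) (by omega))
    (adj hp hp' a (by omega) (by omega) (by omega)) (adj hp hp' u (by omega) (by omega) (by omega))
    (adj hp hp' c (by omega) (by omega) (by omega)) (adj hq hq' a (by omega) (by omega) (by omega))
    (adj hq hq' u (by omega) (by omega) (by omega)) (adj hq hq' c (by omega) (by omega) (by omega))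
    n1.1 n2.1 n3.1 n1.2 n2.2 n3.2

/-- The pairs of vertices whose left end points have to coincide in every mixed unit interval
representation, the one of the second vertex being excluded: an interval together with an interval
in its interior, and the pairs of intervals that touch such a pair from the left. -/
inductive LeftPair (M : CliqueModel G) : ℕ → V → V → Prop
  | inside {p u : V} : M.l p < M.l u → M.r u < M.r p → LeftPair M 0 p u
  | touch {k : ℕ} {v w b t : V} : LeftPair M k v w → M.l v ≤ M.r b → M.r b < M.l w →
      M.l v ≤ M.r t → M.r t < M.l w → M.l b < M.l t → LeftPair M (k + 1) b t

variable {M}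

theorem LeftPair.l_lt (h : M.LeftPair k v w) : M.l v < M.l w := by
  cases h <;> assumption

theorem LeftPair.of_zero (h : M.LeftPair 0 v w) : M.l v < M.l w ∧ M.r w < M.r v := by
  cases h
  constructor <;> assumption

theorem LeftPair.flip_of_zero (h : M.LeftPair 0 v w) : M.flip.LeftPair 0 v w :=
  .inside (by simpa using h.of_zero.2) (by simpa using h.of_zero.1)

variable (M)

/-- The left pairs `(v, w)` of depth `k` start at consecutive integers, and at most two intervals
end at the first of them. -/
def Good (k : ℕ) : Prop :=
  ∀ v w, M.LeftPair k v w → M.l w = M.l v + 1 ∧ ∀ s₁ s₂ s₃, M.r s₁ = M.l v → M.r s₂ = M.l v →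
    M.r s₃ = M.l v → s₁ ≠ s₂ → s₁ ≠ s₃ → s₂ ≠ s₃ → False

variable {M}

theorem LeftPair.prev (hk : M.Good k) (h : M.LeftPair (k + 1) v w) :
    ∃ v' w', M.LeftPair k v' w' ∧ M.r v = M.l v' ∧ M.r w = M.l v' := by
  cases h with
  | touch h h1 h2 h3 h4 h5 =>
    have := (hk _ _ h).1
    exact ⟨_, _, h, by omega, by omega⟩

variable (M)

/-- An induced strip laid out from right to left. -/
structure StripLeft (k : ℕ) (b t : ℕ → V) : Prop where
  strip : IsStrip G k b t
  l_lt : M.l (b (k + 1)) < M.l (t k)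
  le_b : ∀ j ≤ k, M.r (t k) ≤ M.l (b j)
  le_t : ∀ j < k, M.r (t k) ≤ M.l (t j)
  lt_zero : k = 0 → M.r (t 0) < M.l (b 0)

variable {M}

theorem StripLeft.isPendant (h : M.StripLeft k b t) (hs : M.l (b (k + 1)) ≤ M.r s)
    (hs' : M.r s < M.l (t k)) : IsPendant G k b t s := by
  have hadj : G.Adj (t k) (b (k + 1)) := (h.strip.tb k (k + 1) le_rfl le_rfl).2 (by simp)
  have := M.le_of_adj hadj
  have := M.le s
  have := M.le (t k)
  have hb : ∀ j ≤ k, M.r s < M.l (b j) := fun j hj => by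
    have := h.le_b j hj
    omega
  have ht : ∀ j ≤ k, M.r s < M.l (t j) := fun j hj => by
    rcases hj.lt_or_eq with hj | rfl
    · have := h.le_t j hj
      omega
    · exact hs'
  refine ⟨M.adj_of ?_ (by omega) hs, fun j hj => (M.ne_and_not_adj (hb j hj)).1,
    fun j hj => (M.ne_and_not_adj (hb j hj)).2, fun j hj => (M.ne_and_not_adj (ht j hj)).1,
    fun j hj => (M.ne_and_not_adj (ht j hj)).2⟩
  rintro rfl
  omega

/-- Each `touch` step adds one triangle. Goodness at smaller depths makes both touching intervals
end exactly at the first left end of the pair, so they are adjacent pendants. -/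
theorem LeftPair.exists_strip (hgood : ∀ j < k, M.Good j) (h : M.LeftPair k v w) :
    ∃ b t, M.StripLeft k b t ∧ b (k + 1) = v ∧ t k = w := by
  induction h with
  | @inside p u h1 h2 =>
    obtain ⟨c, hc⟩ := M.exists_left u p (M.r u + 1) (by omega) (by omega)
    have hu := M.le u
    have hc' := M.le c
    have hpc : G.Adj c p := by
      refine M.adj_of ?_ (by omega) (by omega)
      rintro rfl
      omega
    have hup : G.Adj u p := by
      refine M.adj_of ?_ (by omega) (by omega)
      rintro rfl
      omega
    have huc := M.ne_and_not_adj (u := u) (v := c) (by omega)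
    refine ⟨fun j => if j = 0 then c else p, fun _ => u, ⟨⟨?_, ?_, ?_, ?_, ?_, ?_⟩, ?_, ?_, ?_, ?_⟩,
      by simp, rfl⟩
    · intro i j hij hj
      obtain ⟨rfl, rfl⟩ : i = 0 ∧ j = 1 := by omega
      simpa using hpc
    · intro i j hi hj
      obtain rfl : i = 0 := by omega
      obtain rfl | rfl : j = 0 ∨ j = 1 := by omega
      · simpa using huc.2
      · simpa using hup
    · omega
    · intro i j hij hj
      obtain ⟨rfl, rfl⟩ : i = 0 ∧ j = 1 := by omega
      simpa using hpc.ne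
    · intro i j hi hj
      obtain rfl | rfl : j = 0 ∨ j = 1 := by omega
      · simpa using huc.1
      · simpa using hup.ne
    · omega
    · simpa using h1
    · intro j hj
      obtain rfl : j = 0 := by omega
      simp [hc]
    · omega
    · intro _
      simp [hc]
  | @touch k v w x y h h1 h2 h3 h4 h5 ih =>
    obtain ⟨b, t, hS, rfl, rfl⟩ := ih fun j hj => hgood j (by omega)
    have e := (hgood k (by omega) _ _ h).1
    have hx := hS.isPendant h1 h2
    have hy := hS.isPendant h3 h4
    have := M.le x
    have := M.le y
    have := M.le (t k)
    have hxy : G.Adj x y := by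
      refine M.adj_of ?_ (by omega) (by omega)
      rintro rfl
      omega
    refine ⟨_, _, ⟨hS.strip.extend hx hy hxy, ?_, ?_, ?_, by omega⟩, by simp, by simp⟩
    · simpa using h5
    · intro j hj
      rw [Function.update_self, Function.update_of_ne (by omega)]
      rcases hj.lt_or_eq with hj | rfl
      · have := hS.le_b j (by omega)
        omega
      · omega
    · intro j hj
      rw [Function.update_self, Function.update_of_ne (by omega)]
      rcases (Nat.lt_succ_iff.1 hj).lt_or_eq with hj | rfl
      · have := hS.le_t j hj
        omega
      · omega

/-- Everything ending between the two left ends is a pendant of the strip, and pendants form a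
clique since `R` is excluded. Excluding `S` makes them end at one integer, and excluding `S'` allows
at most two. The hypothesis `hlink` rules out, at positive depth, an interval that starts between
the left ends and reaches as far as `w`. -/
theorem good_of_not_linked (hG : FamilyFree forbidden G) (hgood : ∀ j < k, M.Good j)
    (hlink : k ≠ 0 → ∀ v w s, M.LeftPair k v w → M.l v < M.l s → M.l s < M.l w →
      M.r w ≤ M.r s → False) : M.Good k := by
  intro v w h
  obtain ⟨b, t, hS, rfl, rfl⟩ := h.exists_strip hgood
  have hw := M.le (t k)
  have htb : M.l (t k) ≤ M.r (b (k + 1)) :=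
    M.le_of_adj ((hS.strip.tb k (k + 1) le_rfl le_rfl).2 (by simp))
  have clique : ∀ {s s'}, M.l (b (k + 1)) ≤ M.r s → M.r s < M.l (t k) →
      M.l (b (k + 1)) ≤ M.r s' → M.r s' < M.l (t k) → s ≠ s' → G.Adj s s' :=
    fun h1 h2 h3 h4 => hG.adj_of_isPendant hS.strip (hS.isPendant h1 h2) (hS.isPendant h3 h4)
  have same : ∀ s s', M.l (b (k + 1)) ≤ M.r s → M.r s < M.l (t k) →
      M.l (b (k + 1)) ≤ M.r s' → M.r s' < M.l (t k) → M.r s < M.r s' → False := by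
    intro s₁ s₂ h1 h2 h3 h4 hlt
    have hadj : G.Adj s₁ s₂ := clique h1 h2 h3 h4 (by rintro rfl; omega)
    have l1 := M.le_of_adj hadj
    have l2 := M.le_of_adj hadj.symm
    -- An interval starting just after `s₁` ends misses `s₁`, so it is no pendant and must reach `t
    -- k`: the extra vertex of `S`.
    obtain ⟨s, hs⟩ := M.exists_left s₁ s₂ (M.r s₁ + 1) (by omega) (by omega)
    have hsr := M.le s
    have hn := M.ne_and_not_adj (u := s₁) (v := s) (by omega)
    have hr : M.l (t k) ≤ M.r s := by
      by_contra! hc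
      exact hn.2 (clique h1 h2 (by omega) hc hn.1)
    -- `s` must not reach the earlier part of the strip. At depth zero this is uniqueness of the
    -- interval around `t k`; otherwise it is `hlink`.
    have hshort : (k = 0 → M.r s ≤ M.r (t k)) ∧ (k ≠ 0 → M.r s < M.r (t k)) := by
      refine ⟨fun hk => ?_, fun hk => ?_⟩
      · subst hk
        by_contra! hc
        have := M.eq_of_inside hG h.of_zero.1 h.of_zero.2 (q := s) (by omega) hc
        rw [this] at h1
        omega
      · by_contra! hc
        exact hlink hk _ _ s h (by omega) (by omega) hc
    refine hG.not_two_isPendant_linked hS.strip (hS.isPendant h1 h2) (hS.isPendant h3 h4) hadj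
      hn.1.symm (by rw [G.adj_comm]; exact hn.2) (M.adj_of ?_ (by omega) (by omega))
      (M.adj_of ?_ (by omega) (by omega)) (M.adj_of ?_ (by omega) (by omega))
      (fun j hj => M.ne_and_not_adj ?_) fun j hj => M.ne_and_not_adj ?_
    · rintro rfl
      omega
    · rintro rfl
      omega
    · rintro rfl
      omega
    · have := hS.le_b j hj
      rcases Nat.eq_zero_or_pos k with rfl | hk
      · obtain rfl : j = 0 := by omega
        have := hS.lt_zero rfl
        have := hshort.1 rfl
        omega
      · have := hshort.2 hk.ne'
        omega
    · have := hS.le_t j hj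
      have := hshort.2 (by omega)
      omega
  refine ⟨?_, fun s₁ s₂ s₃ h1 h2 h3 h12 h13 h23 => ?_⟩
  · by_contra hne
    have hlt := hS.l_lt
    obtain ⟨s₁, hs₁⟩ := M.exists_right (b (k + 1)) (t k) (M.l (b (k + 1))) le_rfl hlt
    obtain ⟨s₂, hs₂⟩ := M.exists_right (b (k + 1)) (t k) (M.l (t k) - 1) (by omega) (by omega)
    exact same s₁ s₂ (by omega) (by omega) (by omega) (by omega) (by omega)
  · have hlt := hS.l_lt
    exact hG.not_three_isPendant hS.strip (hS.isPendant (s := s₁) (by omega) (by omega))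
      (hS.isPendant (s := s₂) (by omega) (by omega)) (hS.isPendant (s := s₃) (by omega) (by omega))
      (clique (by omega) (by omega) (by omega) (by omega) h12)
      (clique (by omega) (by omega) (by omega) (by omega) h13.symm)
      (clique (by omega) (by omega) (by omega) (by omega) h23.symm)

theorem good_zero (hG : FamilyFree forbidden G) (M : CliqueModel G) : M.Good 0 :=
  good_of_not_linked hG (by omega) (by simp)

/-- The left strip ends at `i`, `i + 1` and the right one at `i + 1`, `i`, so exactly three of the
four last pairs intersect: a member of `T`. The conditions `hk` and `hk'` keep the remaining
vertices of each strip clear of the other. -/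
theorem StripLeft.not_clash (hG : FamilyFree forbidden G) (h : M.StripLeft k b t)
    (h' : M.flip.StripLeft k' b' t') (e : M.l (t k) = M.l (b (k + 1)) + 1)
    (e' : M.r (b' (k' + 1)) = M.l (b (k + 1)) + 1) (e'' : M.r (t' k') = M.l (b (k + 1)))
    (hk : k = 0 ∨ M.l (t k) < M.r (t k)) (hk' : k' = 0 ∨ M.l (t' k') < M.r (t' k')) : False := by
  set i := M.l (b (k + 1)) with hi
  have ht := M.le (t k)
  have ht' := M.le (t' k')
  have far_b : ∀ j ≤ k, i + 2 ≤ M.l (b j) := fun j hj => by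
    have := h.le_b j hj
    rcases hk with rfl | hk
    · have := h.lt_zero rfl
      obtain rfl : j = 0 := by omega
      omega
    · omega
  have far_t : ∀ j < k, i + 2 ≤ M.l (t j) := fun j hj => by
    have := h.le_t j hj
    omega
  have far_b' : ∀ j ≤ k', M.r (b' j) ≤ i - 1 := fun j hj => by
    have := h'.le_b j hj
    simp only [flip_l, flip_r] at this
    rcases hk' with rfl | hk
    · have := h'.lt_zero rfl
      simp only [flip_l, flip_r] at this
      obtain rfl : j = 0 := by omega
      omega
    · omega
  have far_t' : ∀ j < k', M.r (t' j) ≤ i - 1 := fun j hj => by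
    have := h'.le_t j hj
    simp only [flip_l, flip_r] at this
    omega
  have all_b : ∀ j ≤ k + 1, i ≤ M.l (b j) := fun j hj => by
    rcases hj.lt_or_eq with hj | rfl
    · have := far_b j (by omega)
      omega
    · rfl
  have all_t : ∀ j ≤ k, i ≤ M.l (t j) := fun j hj => by
    rcases hj.lt_or_eq with hj | rfl
    · have := far_t j (by omega)
      omega
    · omega
  have all_b' : ∀ j ≤ k' + 1, M.r (b' j) ≤ i + 1 := fun j hj => by
    rcases hj.lt_or_eq with hj | rfl
    · have := far_b' j (by omega)
      omega
    · omega
  have all_t' : ∀ j ≤ k', M.r (t' j) ≤ i + 1 := fun j hj => by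
    rcases hj.lt_or_eq with hj | rfl
    · have := far_t' j (by omega)
      omega
    · omega
  have sep : ∀ {x y}, M.r y < M.l x → x ≠ y ∧ ¬ G.Adj x y := fun hxy =>
    ⟨(M.ne_and_not_adj hxy).1.symm, fun hadj => (M.ne_and_not_adj hxy).2 hadj.symm⟩
  have long : i + 2 ≤ M.r (b (k + 1)) :=
    (far_b k le_rfl).trans (M.le_of_adj ((h.strip.bb k (k + 1) (by omega) le_rfl).2 rfl))
  have long' : M.l (b' (k' + 1)) ≤ i - 1 :=
    (M.le_of_adj ((h'.strip.bb k' (k' + 1) (by omega) le_rfl).2 rfl).symm).trans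
      (far_b' k' le_rfl)
  refine hG.not_two_isStrip_linked h.strip h'.strip (M.adj_of ?_ (by omega) (by omega))
    (M.adj_of ?_ (by omega) (by omega)) (M.adj_of ?_ (by omega) (by omega))
    (sep (by omega)).1 (sep (by omega)).2 (fun j hj => ⟨fun l hl => sep ?_, fun l hl => sep ?_⟩)
    (fun j hj => ⟨fun l hl => sep ?_, fun l hl => sep ?_⟩)
    (fun j hj => ⟨fun l hl => sep ?_, fun l hl => sep ?_⟩)
    (fun j hj => ⟨fun l hl => sep ?_, fun l hl => sep ?_⟩)
  · intro hc
    rw [hc] at long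
    omega
  · intro hc
    rw [hc] at long
    omega
  · intro hc
    rw [← hc] at long'
    omega
  · have := far_b j hj
    have := all_b' l hl
    omega
  · have := far_b j hj
    have := all_t' l hl
    omega
  · have := far_t j hj
    have := all_b' l hl
    omega
  · have := far_t j hj
    have := all_t' l hl
    omega
  · have := far_b' j hj
    have := all_b l hl
    omega
  · have := far_b' j hj
    have := all_t l hl
    omega
  · have := far_t' j hj
    have := all_b l hl
    omega
  · have := far_t' j hj
    have := all_t l hl
    omega

/-! ### Left pairs against right pairs -/

/-- A left pair and a right pair cannot meet at consecutive integers. -/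
theorem LeftPair.not_clash_of_good (hG : FamilyFree forbidden G) (k' : ℕ) :
    ∀ {k : ℕ} {v w v' w' : V}, (∀ j ≤ k + k', M.Good j) → (∀ j ≤ k', M.flip.Good j) →
    M.LeftPair k v w → M.flip.LeftPair k' v' w' → M.r v' = M.l v + 1 → False := by
  -- The depth `k` must stay general: the degenerate case shortens the right pair by one and
  -- lengthens the left pair by one, which keeps `k + k'` within the range where goodness is known.
  induction k' with
  | zero =>
    intro k v w v' w' hgood hgood' h h' e
    have e1 := (hgood k (by omega) _ _ h).1
    have e2 := (hgood' 0 le_rfl _ _ h').1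
    simp only [flip_l] at e2
    have hw := M.le w
    have hw' := M.le w'
    have hin := h'.of_zero
    simp only [flip_l, flip_r] at hin
    by_cases hk : k = 0 ∨ M.l w < M.r w
    · obtain ⟨b, t, hS, rfl, rfl⟩ := h.exists_strip fun j hj => hgood j (by omega)
      obtain ⟨b', t', hS', rfl, rfl⟩ := h'.exists_strip (by omega)
      exact hS.not_clash hG hS' e1 e (by omega) hk (.inl rfl)
    -- Here `w` is a single integer, so `v`, `w` and `v'` all end where the previous left pair
    -- starts, one too many.
    · obtain ⟨k, rfl⟩ : ∃ j, k = j + 1 := ⟨k - 1, by omega⟩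
      have hk' := hgood k (by omega)
      obtain ⟨v₁, w₁, h₁, e3, e4⟩ := h.prev hk'
      refine (hk' _ _ h₁).2 v w v' e3 e4 (by omega) ?_ ?_ ?_
      all_goals
        rintro rfl
        omega
  | succ k' ih =>
    intro k v w v' w' hgood hgood' h h' e
    have e1 := (hgood k (by omega) _ _ h).1
    have e2 := (hgood' _ le_rfl _ _ h').1
    simp only [flip_l] at e2
    have hw := M.le w
    have hw' := M.le w'
    obtain ⟨v₂, w₂, h₂, e5, e6⟩ := h'.prev (hgood' k' (by omega))
    have e7 := (hgood' k' (by omega) _ _ h₂).1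
    simp only [flip_l, flip_r] at e5 e6 e7
    have hlt := h₂.l_lt
    simp only [flip_l] at hlt
    have hw₂ := M.le w₂
    by_cases hk : k = 0 ∨ M.l w < M.r w
    · by_cases hk' : M.l w' < M.r w'
      · obtain ⟨b, t, hS, rfl, rfl⟩ := h.exists_strip fun j hj => hgood j (by omega)
        obtain ⟨b', t', hS', rfl, rfl⟩ := h'.exists_strip fun j hj => hgood' j (by omega)
        exact hS.not_clash hG hS' e1 e (by omega) hk (.inr hk')
      · have hrv : M.l v < M.r v ∧ M.r v ≠ M.l v + 1 := by
          rcases Nat.eq_zero_or_pos k with rfl | hpos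
          · have := h.of_zero
            omega
          · obtain ⟨k, rfl⟩ : ∃ j, k = j + 1 := ⟨k - 1, by omega⟩
            obtain ⟨v₁, w₁, h₁, e3, e4⟩ := h.prev (hgood k (by omega))
            omega
        refine (hgood' k' (by omega) _ _ h₂).2 v' w' v (by simp; omega) (by simp; omega)
          (by simp; omega) ?_ ?_ ?_
        · rintro rfl
          omega
        · rintro rfl
          omega
        · rintro rfl
          omega
    · obtain ⟨k, rfl⟩ : ∃ j, k = j + 1 := ⟨k - 1, by omega⟩
      have hk' := hgood k (by omega)
      obtain ⟨v₁, w₁, h₁, e3, e4⟩ := h.prev hk'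
      -- Again three intervals would end where the previous left pair starts, unless `v'` and `v`
      -- are the same vertex.
      have hvv : v' = v := by
        by_contra hne
        refine (hk' _ _ h₁).2 v w v' e3 e4 (by omega) ?_ (Ne.symm hne) ?_
        · rintro rfl
          omega
        · rintro rfl
          omega
      subst hvv
      have hl : M.l v₂ ≤ M.r v₂ := M.le v₂
      have hlv : M.l v₂ < M.l w' := by
        by_contra! hc
        have hlw : M.l v₂ ≤ M.l w₂ := by
          rcases Nat.eq_zero_or_pos k' with rfl | hpos
          · have := h₂.of_zero
            simp only [flip_l, flip_r] at this
            omega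
          · obtain ⟨k', rfl⟩ : ∃ j, k' = j + 1 := ⟨k' - 1, by omega⟩
            obtain ⟨v₃, w₃, h₃, e8, e9⟩ := h₂.prev (hgood' k' (by omega))
            simp only [flip_l, flip_r] at e8 e9
            omega
        omega
      -- Both `v₂` and `w'` end where `v` starts, so they form a deeper left pair, which clashes
      -- with the shallower right pair at `v₂` itself.
      have hnew : M.LeftPair (k + 1 + 1) v₂ w' :=
        .touch h (by omega) (by omega) (by omega) (by omega) hlv
      have e8 := (hgood _ (by omega) _ _ hnew).1
      exact ih (fun j hj => hgood j (by omega)) (fun j hj => hgood' j (by omega)) hnew h₂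
        (by omega)

/-- A linking `s` either ends with `v` and `w`, giving three intervals at the start of the previous
pair, or strictly contains `w`; then `(s, w)` is a right pair clashing with that previous pair. -/
theorem good (hG : FamilyFree forbidden G) (M : CliqueModel G) (k : ℕ) : M.Good k := by
  induction k using Nat.strong_induction_on with
  | _ k ih =>
    refine good_of_not_linked hG ih fun hk v w s h h1 h2 h3 => ?_
    obtain ⟨k, rfl⟩ : ∃ j, k = j + 1 := ⟨k - 1, by omega⟩
    have hk' := ih k (by omega)
    obtain ⟨v₁, w₁, h₁, e3, e4⟩ := h.prev hk'
    rcases h3.eq_or_lt with h3 | h3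
    · refine (hk' _ _ h₁).2 v w s e3 e4 (by omega) ?_ ?_ ?_
      all_goals
        rintro rfl
        omega
    · have hs : M.LeftPair 0 s w := .inside h2 h3
      have e5 := (good_zero hG M.flip _ _ hs.flip_of_zero).1
      simp only [flip_l] at e5
      exact h₁.not_clash_of_good hG 0 (fun j hj => ih j (by omega))
        (fun j hj => by obtain rfl : j = 0 := by omega
                        exact good_zero hG M.flip) hs.flip_of_zero (by omega)

theorem LeftPair.not_clash (hG : FamilyFree forbidden G) (h : M.LeftPair k v w)
    (h' : M.flip.LeftPair k' p q) : M.r p ≠ M.l v + 1 := fun e =>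
  h.not_clash_of_good hG k' (fun j _ => good hG M j) (fun j _ => good hG M.flip j) h' e

/-! ### Modified intervals, with forced ends merged -/

variable {M : CliqueModel G} {k k' : ℕ} {s s' u v w y z : V} {i : ℤ}

theorem LeftPair.l_eq (hG : FamilyFree forbidden G) (h : M.LeftPair k v w) : M.l w = M.l v + 1 :=
  (good hG M k v w h).1

theorem LeftPair.r_eq_of_zero (hG : FamilyFree forbidden G) (h : M.LeftPair 0 v w) :
    M.r v = M.r w + 1 := by
  have := h.flip_of_zero.l_eq hG
  simp only [flip_l] at this
  omega

/-- The second vertex of a left pair: its left end point has to be excluded. -/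
def LeftOpen (M : CliqueModel G) (v : V) : Prop := ∃ k y, M.LeftPair k y v

/-- Some left pair starts at `i`. -/
def LeftTight (M : CliqueModel G) (i : ℤ) : Prop := ∃ k v w, M.LeftPair k v w ∧ M.l v = i

/-- Thus the partner of an open left end keeps its own. A second pair ending in `v` would put `w`
inside two intervals, produce a clash, or make three intervals end at the previous pair. -/
theorem LeftPair.not_leftOpen (hG : FamilyFree forbidden G) (h : M.LeftPair k v w) :
    ¬ M.LeftOpen v := by
  rintro ⟨k', y, h'⟩
  have e := h.l_eq hG
  have e' := h'.l_eq hG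
  rcases k with _ | k
  · have hin := h.of_zero
    have hr : M.r v ≤ M.r y := by
      rcases k' with _ | k'
      · have := h'.of_zero
        omega
      · obtain ⟨v₁, w₁, -, e1, e2⟩ := h'.prev (good hG M k')
        omega
    have := M.eq_of_inside hG hin.1 hin.2 (q := y) (by omega) (by omega)
    subst this
    omega
  · obtain ⟨v₁, w₁, h₁, e1, e2⟩ := h.prev (good hG M k)
    rcases k' with _ | k'
    · have := h'.r_eq_of_zero hG
      exact h₁.not_clash hG h'.flip_of_zero (by omega)
    · obtain ⟨v₂, w₂, -, e3, e4⟩ := h'.prev (good hG M k')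
      refine (good hG M k _ _ h₁).2 y v w (by omega) e1 e2 ?_ ?_ ?_
      all_goals
        rintro rfl
        omega

theorem LeftPair.not_rightOpen_right (hG : FamilyFree forbidden G) (h : M.LeftPair (k + 1) v w) :
    ¬ M.flip.LeftOpen w := by
  rintro ⟨k', y, h'⟩
  have e' := h'.l_eq hG
  simp only [flip_l] at e'
  obtain ⟨v₁, w₁, h₁, e1, e2⟩ := h.prev (good hG M k)
  exact h₁.not_clash hG h' (by omega)

theorem LeftPair.not_rightOpen (hG : FamilyFree forbidden G) (h : M.LeftPair k v w) :
    ¬ M.flip.LeftOpen v := by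
  rcases k with _ | k
  · exact h.flip_of_zero.not_leftOpen hG
  · rintro ⟨k', y, h'⟩
    have e' := h'.l_eq hG
    simp only [flip_l] at e'
    obtain ⟨v₁, w₁, h₁, e1, e2⟩ := h.prev (good hG M k)
    exact h₁.not_clash hG h' (by omega)

open Classical in
/-- The left end point of the closed hull of the modified interval of `v`. -/
noncomputable def left (M : CliqueModel G) (v : V) : ℤ := if M.LeftOpen v then M.l v - 1 else M.l v

/-- The right end point of the closed hull of the modified interval of `v`. -/
noncomputable def right (M : CliqueModel G) (v : V) : ℤ := -M.flip.left v

theorem left_of_open (h : M.LeftOpen v) : M.left v = M.l v - 1 := if_pos h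

theorem left_of_not_open (h : ¬ M.LeftOpen v) : M.left v = M.l v := if_neg h

theorem right_of_open (h : M.flip.LeftOpen v) : M.right v = M.r v + 1 := by
  rw [right, left_of_open h, flip_l]
  omega

theorem right_of_not_open (h : ¬ M.flip.LeftOpen v) : M.right v = M.r v := by
  rw [right, left_of_not_open h, flip_l]
  omega

theorem flip_left : M.flip.left v = -M.right v := (neg_neg _).symm

theorem flip_right : M.flip.right v = -M.left v := by rw [right, flip_flip]

theorem left_le : M.left v ≤ M.l v := by
  by_cases h : M.LeftOpen v
  · rw [left_of_open h]; omega
  · rw [left_of_not_open h]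

theorem le_right : M.r v ≤ M.right v := by
  by_cases h : M.flip.LeftOpen v
  · rw [right_of_open h]; omega
  · rw [right_of_not_open h]

theorem left_le_right : M.left v ≤ M.right v := left_le.trans ((M.le v).trans le_right)

theorem LeftPair.left_left (hG : FamilyFree forbidden G) (h : M.LeftPair k v w) :
    M.left v = M.l v := left_of_not_open (h.not_leftOpen hG)

theorem LeftPair.right_left (hG : FamilyFree forbidden G) (h : M.LeftPair k v w) :
    M.right v = M.r v := right_of_not_open (h.not_rightOpen hG)

theorem LeftPair.left_right (hG : FamilyFree forbidden G) (h : M.LeftPair k v w) :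
    M.left w = M.l v := by
  rw [left_of_open ⟨k, v, h⟩, h.l_eq hG]
  omega

theorem LeftPair.right_right (hG : FamilyFree forbidden G) (h : M.LeftPair k v w) :
    M.right w = M.r v := by
  rcases k with _ | k
  · rw [right_of_open ⟨0, v, h.flip_of_zero⟩, h.r_eq_of_zero hG]
  · rw [right_of_not_open (h.not_rightOpen_right hG)]
    obtain ⟨v₁, w₁, -, e1, e2⟩ := h.prev (good hG M k)
    omega

/-- The partner of an open vertex is unmodified and has the same modified interval. This lets
statements about modified intervals be tested on original ones. -/
theorem exists_closed (hG : FamilyFree forbidden G) (s : V) :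
    ∃ s', ¬ M.LeftOpen s' ∧ ¬ M.flip.LeftOpen s' ∧ M.l s' = M.left s ∧ M.r s' = M.right s := by
  by_cases h : M.LeftOpen s
  · obtain ⟨k, y, h⟩ := h
    exact ⟨y, h.not_leftOpen hG, h.not_rightOpen hG, (h.left_right hG).symm,
      (h.right_right hG).symm⟩
  · by_cases h' : M.flip.LeftOpen s
    · obtain ⟨k, y, h'⟩ := h'
      have e1 := h'.left_right hG
      have e2 := h'.right_right hG
      simp only [flip_left, flip_right, flip_l, flip_r, neg_inj] at e1 e2
      have := h'.not_rightOpen hG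
      rw [flip_flip] at this
      exact ⟨y, this, h'.not_leftOpen hG, e2.symm, e1.symm⟩
    · exact ⟨s, h, h', (left_of_not_open h).symm, (right_of_not_open h').symm⟩

/-- The modified intervals are not nested. -/
theorem not_nested (hG : FamilyFree forbidden G) (h : M.left v < M.left w) :
    M.right v ≤ M.right w := by
  by_contra! hc
  obtain ⟨v', -, -, e1, e2⟩ := M.exists_closed hG v
  obtain ⟨w', h1, -, e3, e4⟩ := M.exists_closed hG w
  exact h1 ⟨0, v', .inside (by omega) (by omega)⟩

/-- Unmodified representatives ending at `i` with different left ends would form a further left pair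
and hence be modified. Collapsing all right ends at a tight integer is therefore harmless. -/
theorem LeftTight.left_eq (hG : FamilyFree forbidden G) (hi : M.LeftTight i) (hs : M.right s = i)
    (hs' : M.right s' = i) : M.left s = M.left s' := by
  obtain ⟨k, v, w, h, rfl⟩ := hi
  obtain ⟨a, ha, -, e1, e2⟩ := M.exists_closed hG s
  obtain ⟨a', ha', -, e3, e4⟩ := M.exists_closed hG s'
  have := h.l_lt
  rcases lt_trichotomy (M.l a) (M.l a') with hlt | heq | hlt
  · exact (ha' ⟨k + 1, a, .touch h (by omega) (by omega) (by omega) (by omega) hlt⟩).elim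
  · omega
  · exact (ha ⟨k + 1, a', .touch h (by omega) (by omega) (by omega) (by omega) hlt⟩).elim

/-- A longer interval with the same start would contain `w` strictly and force a different modified
right end on it. -/
theorem LeftPair.right_le (hG : FamilyFree forbidden G) (h : M.LeftPair k v w)
    (hz : M.left z = M.l v) : M.right z ≤ M.r v := by
  by_contra! hc
  obtain ⟨z', -, -, e1, e2⟩ := M.exists_closed hG z
  have e := h.l_eq hG
  have e' := h.right_right hG
  have hle : M.r w ≤ M.r v := e' ▸ le_right
  have hz' : M.LeftPair 0 z' w := .inside (by omega) (by omega)
  rw [hz'.right_right hG] at e'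
  omega

open Classical in
/-- The common right end point of the left pairs which start at `i`. -/
noncomputable def leftEnd (M : CliqueModel G) (i : ℤ) : ℤ :=
  -- The value at integers that are not tight is arbitrary.
  if h : M.LeftTight i then M.r h.choose_spec.choose else 0

/-- The common left end point of the right pairs which end at `i`. -/
noncomputable def rightEnd (M : CliqueModel G) (i : ℤ) : ℤ := -M.flip.leftEnd (-i)

theorem LeftTight.exists_pair (hi : M.LeftTight i) :
    ∃ k v w, M.LeftPair k v w ∧ M.l v = i ∧ M.leftEnd i = M.r v := by
  obtain ⟨w, hw⟩ := hi.choose_spec.choose_spec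
  exact ⟨_, _, w, hw.1, hw.2, dif_pos hi⟩

theorem LeftTight.right_le_leftEnd (hG : FamilyFree forbidden G) (hi : M.LeftTight i)
    (hz : M.left z = i) : M.right z ≤ M.leftEnd i := by
  obtain ⟨k, v, w, h, rfl, e⟩ := hi.exists_pair
  exact e ▸ h.right_le hG hz

theorem LeftPair.leftEnd_eq (hG : FamilyFree forbidden G) (h : M.LeftPair k v w) :
    M.leftEnd (M.l v) = M.r v := by
  obtain ⟨k', v', w', h', e, e'⟩ := LeftTight.exists_pair ⟨k, v, w, h, rfl⟩
  have h1 := h.right_le hG (z := v') (by rw [h'.left_left hG, e])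
  have h2 := h'.right_le hG (z := v) (by rw [h.left_left hG, e])
  rw [h'.right_left hG] at h1
  rw [h.right_left hG] at h2
  omega

theorem LeftTight.lt_leftEnd (hG : FamilyFree forbidden G) (hi : M.LeftTight i) :
    i < M.leftEnd i := by
  obtain ⟨k, v, w, h, rfl, e⟩ := hi.exists_pair
  have e' := h.l_eq hG
  have hle : M.r w ≤ M.r v := h.right_right hG ▸ le_right
  have := M.le w
  omega

theorem LeftOpen.leftTight (hG : FamilyFree forbidden G) (h : M.LeftOpen v) :
    M.LeftTight (M.left v) := by
  obtain ⟨k, y, h⟩ := h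
  exact ⟨k, y, v, h, (h.left_right hG).symm⟩

theorem LeftOpen.right_eq (hG : FamilyFree forbidden G) (h : M.LeftOpen v) :
    M.right v = M.leftEnd (M.left v) := by
  obtain ⟨k, y, h⟩ := h
  rw [h.left_right hG, h.leftEnd_eq hG, h.right_right hG]

/-- Some right pair ends at `i`. -/
def RightTight (M : CliqueModel G) (i : ℤ) : Prop := M.flip.LeftTight (-i)

theorem RightTight.right_eq (hG : FamilyFree forbidden G) (hi : M.RightTight i)
    (hs : M.left s = i) (hs' : M.left s' = i) : M.right s = M.right s' := by
  have := LeftTight.left_eq hG (s := s) (s' := s') hi (by rw [flip_right, hs])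
    (by rw [flip_right, hs'])
  rw [flip_left, flip_left] at this
  omega

theorem RightTight.rightEnd_le_left (hG : FamilyFree forbidden G) (hi : M.RightTight i)
    (hz : M.right z = i) : M.rightEnd i ≤ M.left z := by
  have := LeftTight.right_le_leftEnd hG (z := z) hi (by rw [flip_left, hz])
  rw [flip_right] at this
  rw [rightEnd]
  omega

theorem RightTight.rightEnd_lt (hG : FamilyFree forbidden G) (hi : M.RightTight i) :
    M.rightEnd i < i := by
  have := LeftTight.lt_leftEnd hG hi
  rw [rightEnd]
  omega

theorem rightTight_of_open (hG : FamilyFree forbidden G) (h : M.flip.LeftOpen v) :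
    M.RightTight (M.right v) := by
  have := h.leftTight hG
  rwa [flip_left] at this

theorem left_eq_of_open (hG : FamilyFree forbidden G) (h : M.flip.LeftOpen v) :
    M.left v = M.rightEnd (M.right v) := by
  have := h.right_eq hG
  rw [flip_left, flip_right] at this
  rw [rightEnd]
  omega

theorem RightTight.exists_right (hG : FamilyFree forbidden G) (hi : M.RightTight i) :
    ∃ s, M.right s = i ∧ M.left s < i := by
  obtain ⟨k, v, w, h, e⟩ := hi
  have e1 := h.left_left hG
  have e2 := h.right_left hG
  have e3 := h.l_eq hG
  have hle : M.flip.r w ≤ M.flip.r v := h.right_right hG ▸ le_right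
  have := M.le w
  simp only [flip_left, flip_right, flip_l, flip_r] at *
  exact ⟨v, by omega, by omega⟩

/-! ### Breaking ties among the ends at one integer -/

open Classical in
/-- The position of the left end point of `v` in the final representation. -/
noncomputable def leftPos (M : CliqueModel G) (v : V) : ℤ ×ₗ ℤ ×ₗ ℤ :=
  -- By default left ends come at level 0, ordered by right ends. If a right pair ends here, all of
  -- them collapse onto its right end at level 1.
  toLex (M.left v, if M.RightTight (M.left v) then toLex (1, M.rightEnd (M.left v))
    else toLex (0, M.right v))

open Classical in
/-- The position of the right end point of `v` in the final representation. -/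
noncomputable def rightPos (M : CliqueModel G) (v : V) : ℤ ×ₗ ℤ ×ₗ ℤ :=
  -- By default right ends come at level 1, ordered by left ends, hence after the left ends. At a
  -- left-tight integer they collapse onto the left end of the left pair, or onto the common point
  -- if a right pair ends there too.
  toLex (M.right v, if M.LeftTight (M.right v) then
      if M.RightTight (M.right v) then toLex (1, M.rightEnd (M.right v))
      else toLex (0, M.leftEnd (M.right v))
    else toLex (1, M.left v))

/-- The modified intervals can at most touch, since two open ends facing each other across adjacent
integers would be a clash. If they touch, the integer is tight and the collapse makes the two
positions equal. -/
theorem rightPos_le_leftPos (hG : FamilyFree forbidden G) (h : M.r v < M.l w) :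
    M.rightPos v < M.leftPos w ∨
      M.rightPos v = M.leftPos w ∧ (M.LeftOpen w ∨ M.flip.LeftOpen v) := by
  by_cases hlt : M.right v < M.left w
  · exact .inl (Prod.Lex.toLex_lt_toLex.2 (.inl hlt))
  have hle : M.right v ≤ M.left w := by
    by_cases hw : M.LeftOpen w <;> by_cases hv : M.flip.LeftOpen v
    · rw [left_of_open hw, right_of_open hv]
      obtain ⟨k, y, hw⟩ := hw
      obtain ⟨k', z, hv⟩ := hv
      have := hw.not_clash hG hv
      have := hw.l_eq hG
      have := hv.l_eq hG
      simp only [flip_l] at this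
      omega
    · rw [left_of_open hw, right_of_not_open hv]
      omega
    · rw [left_of_not_open hw, right_of_open hv]
      omega
    · rw [left_of_not_open hw, right_of_not_open hv]
      omega
  have heq : M.right v = M.left w := by omega
  right
  by_cases hv : M.flip.LeftOpen v
  · refine ⟨?_, .inr hv⟩
    have h1 := rightTight_of_open hG hv
    have h2 := left_eq_of_open hG hv
    rw [rightPos, leftPos, ← heq, if_pos h1, if_pos h1, ← h2]
    simp
  · by_cases hw : M.LeftOpen w
    · refine ⟨?_, .inl hw⟩
      have h1 := hw.leftTight hG
      have h2 := hw.right_eq hG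
      rw [rightPos, leftPos, heq, if_pos h1, ← h2]
    · rw [left_of_not_open hw, right_of_not_open hv] at heq
      omega

theorem leftPos_le_rightPos (hG : FamilyFree forbidden G) (h : M.l w ≤ M.r v) :
    M.leftPos w < M.rightPos v ∨
      M.leftPos w = M.rightPos v ∧ ¬ M.LeftOpen w ∧ ¬ M.flip.LeftOpen v := by
  have hw : M.left w ≤ M.l w := left_le
  have hv : M.r v ≤ M.right v := le_right
  by_cases hlt : M.left w < M.right v
  · exact .inl (Prod.Lex.toLex_lt_toLex.2 (.inl hlt))
  have heq : M.left w = M.right v := by omega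
  suffices M.leftPos w ≤ M.rightPos v by
    rcases this.lt_or_eq with h | h
    · exact .inl h
    · refine .inr ⟨h, fun ho => ?_, fun ho => ?_⟩
      · have := left_of_open ho
        omega
      · have := right_of_open ho
        omega
  rw [leftPos, rightPos, heq]
  refine Prod.Lex.toLex_le_toLex.2 (.inr ⟨rfl, ?_⟩)
  by_cases hL : M.LeftTight (M.right v) <;> by_cases hR : M.RightTight (M.right v)
  · simp [hL, hR]
  · simp only [hL, hR, if_true, if_false]
    exact Prod.Lex.toLex_le_toLex.2 (.inr ⟨rfl, hL.right_le_leftEnd hG heq⟩)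
  · simp only [hL, hR, if_true, if_false]
    exact Prod.Lex.toLex_le_toLex.2 (.inr ⟨rfl, hR.rightEnd_le_left hG rfl⟩)
  · simp only [hL, hR, if_false]
    exact Prod.Lex.toLex_le_toLex.2 (.inl one_pos)

theorem leftPos_lt_rightPos (hG : FamilyFree forbidden G) (v : V) :
    M.leftPos v < M.rightPos v := by
  rcases (left_le_right (M := M) (v := v)).lt_or_eq with h | h
  · exact Prod.Lex.toLex_lt_toLex.2 (.inl h)
  rw [leftPos, rightPos, h]
  refine Prod.Lex.toLex_lt_toLex.2 (.inr ⟨rfl, ?_⟩)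
  by_cases hL : M.LeftTight (M.right v) <;> by_cases hR : M.RightTight (M.right v)
  -- Total collapse of `v` to a point is impossible: the right pair supplies an interval of positive
  -- length ending here, while left tightness makes all intervals ending here start together.
  · obtain ⟨s, hs, hs'⟩ := hR.exists_right hG
    have := hL.left_eq hG hs rfl
    omega
  · simp only [hL, hR, if_true, if_false]
    exact Prod.Lex.toLex_lt_toLex.2 (.inr ⟨rfl, hL.lt_leftEnd hG⟩)
  · simp only [hL, hR, if_true, if_false]
    exact Prod.Lex.toLex_lt_toLex.2 (.inr ⟨rfl, hR.rightEnd_lt hG⟩)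
  · simp only [hL, hR, if_false]
    exact Prod.Lex.toLex_lt_toLex.2 (.inl one_pos)

/-- A tie in one end is broken by the other. A collapse cannot spoil this, because tightness there
would already make the other ends equal. -/
theorem pos_lt (hG : FamilyFree forbidden G) (hl : M.left v ≤ M.left w)
    (hr : M.right v ≤ M.right w) (hne : M.left v ≠ M.left w ∨ M.right v ≠ M.right w) :
    M.leftPos v < M.leftPos w ∧ M.rightPos v < M.rightPos w := by
  constructor
  · refine Prod.Lex.toLex_lt_toLex.2 ?_
    rcases hl.lt_or_eq with h | h
    · exact .inl h
    · refine .inr ⟨h, ?_⟩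
      have hR : ¬ M.RightTight (M.left w) := fun hR =>
        (hne.resolve_left (not_not.2 h)) (hR.right_eq hG h rfl)
      simp only [h, hR, if_false]
      exact Prod.Lex.toLex_lt_toLex.2
        (.inr ⟨rfl, lt_of_le_of_ne hr (hne.resolve_left (not_not.2 h))⟩)
  · refine Prod.Lex.toLex_lt_toLex.2 ?_
    rcases hr.lt_or_eq with h | h
    · exact .inl h
    · refine .inr ⟨h, ?_⟩
      have hL : ¬ M.LeftTight (M.right w) := fun hL =>
        (hne.resolve_right (not_not.2 h)) (hL.left_eq hG h rfl)
      simp only [h, hL, if_false]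
      exact Prod.Lex.toLex_lt_toLex.2
        (.inr ⟨rfl, lt_of_le_of_ne hl (hne.resolve_right (not_not.2 h))⟩)

theorem leftPos_lt_iff (hG : FamilyFree forbidden G) :
    M.leftPos v < M.leftPos w ↔ M.rightPos v < M.rightPos w := by
  by_cases hne : M.left v ≠ M.left w ∨ M.right v ≠ M.right w
  · have cases : (M.left v ≤ M.left w ∧ M.right v ≤ M.right w) ∨
        (M.left w ≤ M.left v ∧ M.right w ≤ M.right v) := by
      rcases lt_trichotomy (M.left v) (M.left w) with h | h | h
      · exact .inl ⟨h.le, not_nested hG h⟩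
      · rcases le_total (M.right v) (M.right w) with h' | h'
        · exact .inl ⟨h.le, h'⟩
        · exact .inr ⟨h.ge, h'⟩
      · exact .inr ⟨h.le, not_nested hG h⟩
    rcases cases with ⟨h1, h2⟩ | ⟨h1, h2⟩
    · have := pos_lt hG h1 h2 hne
      simp [this]
    · have := pos_lt hG h1 h2 (hne.imp Ne.symm Ne.symm)
      simp [this.1.not_gt, this.2.not_gt]
  · push Not at hne
    rw [leftPos, leftPos, rightPos, rightPos, hne.1, hne.2]
    simp only [lt_self_iff_false]

end CliqueModel

/-! ### Making all intervals have unit length -/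

/-- Induction on the largest left end. Its interval also has the largest right end, so it suffices
to insert its left end in order; since this exceeds all earlier left ends, one unit further lies
beyond all earlier right ends. -/
theorem exists_unit_scale {α : Type*} [LinearOrder α] (S : Finset (α × α))
    (hlt : ∀ p ∈ S, p.1 < p.2) (hmono : ∀ p ∈ S, ∀ q ∈ S, p.1 < q.1 ↔ p.2 < q.2) :
    ∃ φ : α → ℝ, StrictMonoOn φ {a | ∃ p ∈ S, a = p.1 ∨ a = p.2} ∧
      ∀ p ∈ S, φ p.2 = φ p.1 + 1 := by
  revert hlt hmono
  refine Finset.induction_on_max_value Prod.fst S ?_ ?_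
  · exact fun _ _ => ⟨fun _ => 0, by simp [StrictMonoOn], by simp⟩
  · intro q S hq hmax ih hlt hmono
    have hmem : ∀ {p}, p ∈ S → p ∈ insert q S := Finset.mem_insert_of_mem
    have hself : q ∈ insert q S := Finset.mem_insert_self q S
    obtain ⟨φ, hφ, hφ'⟩ := ih (fun p hp => hlt p (hmem hp))
      fun p hp p' hp' => hmono p (hmem hp) p' (hmem hp')
    have hq1 : ∀ p ∈ S, p.1 < q.1 := fun p hp => by
      refine lt_of_le_of_ne (hmax p hp) fun h => ?_
      have h1 := hmono p (hmem hp) q hself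
      have h2 := hmono q hself p (hmem hp)
      rw [h] at h1 h2
      have : p.2 = q.2 := le_antisymm (not_lt.1 fun h => (h2.2 h).false)
        (not_lt.1 fun h => (h1.2 h).false)
      exact hq (Prod.ext h this ▸ hp)
    have hq2 : ∀ p ∈ S, p.2 < q.2 := fun p hp => (hmono p (hmem hp) q hself).1 (hq1 p hp)
    have hqq := hlt q hself
    set E : Finset α := S.image Prod.fst ∪ S.image Prod.snd with hE
    have memE : ∀ {a}, a ∈ E ↔ ∃ p ∈ S, a = p.1 ∨ a = p.2 := fun {a} => by
      simp only [hE, Finset.mem_union, Finset.mem_image]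
      constructor
      · rintro (⟨p, hp, rfl⟩ | ⟨p, hp, rfl⟩)
        · exact ⟨p, hp, .inl rfl⟩
        · exact ⟨p, hp, .inr rfl⟩
      · rintro ⟨p, hp, rfl | rfl⟩
        · exact .inl ⟨p, hp, rfl⟩
        · exact .inr ⟨p, hp, rfl⟩
    have hφE : ∀ a ∈ E, ∀ b ∈ E, a < b → φ a < φ b := fun a ha b hb h =>
      hφ (memE.1 ha) (memE.1 hb) h
    have hEq : ∀ a ∈ E, a < q.2 := fun a ha => by
      obtain ⟨p, hp, rfl | rfl⟩ := memE.1 ha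
      · exact (hq1 p hp).trans hqq
      · exact hq2 p hp
    -- The new left end may coincide with an earlier right end, whose value is then kept.
    obtain ⟨y, hylo, hyhi, hyeq⟩ : ∃ y : ℝ, (∀ a ∈ E, a < q.1 → φ a < y) ∧
        (∀ a ∈ E, q.1 < a → y < φ a) ∧ (q.1 ∈ E → φ q.1 = y) := by
      by_cases hqE : q.1 ∈ E
      · exact ⟨φ q.1, fun a ha h => hφE a ha _ hqE h, fun a ha h => hφE _ hqE a ha h,
          fun _ => rfl⟩
      · obtain ⟨y, h1, h2⟩ := Order.exists_between_finsets ((E.filter (· < q.1)).image φ)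
          ((E.filter (q.1 < ·)).image φ) (by
            simp only [Finset.mem_image, Finset.mem_filter]
            rintro _ ⟨a, ⟨ha, ha'⟩, rfl⟩ _ ⟨b, ⟨hb, hb'⟩, rfl⟩
            exact hφE a ha b hb (ha'.trans hb'))
        refine ⟨y, fun a ha h => h1 _ ?_, fun a ha h => h2 _ ?_, fun h => (hqE h).elim⟩
        · exact Finset.mem_image_of_mem _ (Finset.mem_filter.2 ⟨ha, h⟩)
        · exact Finset.mem_image_of_mem _ (Finset.mem_filter.2 ⟨ha, h⟩)
    have hy1 : ∀ a ∈ E, φ a < y + 1 := fun a ha => by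
      obtain ⟨p, hp, rfl | rfl⟩ := memE.1 ha
      · have := hylo _ ha (hq1 p hp)
        linarith
      · have := hylo p.1 (memE.2 ⟨p, hp, .inl rfl⟩) (hq1 p hp)
        rw [hφ' p hp]
        linarith
    set ψ : α → ℝ := Function.update (Function.update φ q.1 y) q.2 (y + 1) with hψ
    have ψq2 : ψ q.2 = y + 1 := by simp [hψ]
    have ψq1 : ψ q.1 = y := by simp [hψ, Function.update_of_ne hqq.ne]
    have ψE : ∀ a ∈ E, ψ a = φ a := fun a ha => by
      rw [hψ, Function.update_of_ne (hEq a ha).ne]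
      by_cases h : a = q.1
      · rw [h, Function.update_self, hyeq (h ▸ ha)]
      · rw [Function.update_of_ne h]
    refine ⟨ψ, ?_, fun p hp => ?_⟩
    · have cases : ∀ a, (∃ p ∈ insert q S, a = p.1 ∨ a = p.2) → a ∈ E ∨ a = q.1 ∨ a = q.2 := by
        rintro a ⟨p, hp, h⟩
        rcases Finset.mem_insert.1 hp with rfl | hp
        · exact .inr h
        · exact .inl (memE.2 ⟨p, hp, h⟩)
      intro a ha b hb hab
      rcases cases a ha with ha | rfl | rfl <;> rcases cases b hb with hb | rfl | rfl
      · rw [ψE a ha, ψE b hb]; exact hφE a ha b hb hab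
      · rw [ψE a ha, ψq1]; exact hylo a ha hab
      · rw [ψE a ha, ψq2]; exact hy1 a ha
      · rw [ψE b hb, ψq1]; exact hyhi b hb hab
      · exact (hab.false).elim
      · rw [ψq1, ψq2]; linarith
      · exact ((hEq b hb).not_gt hab).elim
      · exact (hqq.not_gt hab).elim
      · exact (hab.false).elim
    · rcases Finset.mem_insert.1 hp with rfl | hp
      · rw [ψq1, ψq2]
      · rw [ψE _ (memE.2 ⟨p, hp, .inl rfl⟩), ψE _ (memE.2 ⟨p, hp, .inr rfl⟩), hφ' p hp]

theorem CliqueModel.nonempty_unitRep [Finite V] (hG : FamilyFree forbidden G)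
    (M : CliqueModel G) : Nonempty (UnitRep G) := by
  classical
  have := Fintype.ofFinite V
  obtain ⟨φ, hφ, hunit⟩ := exists_unit_scale
    (Finset.univ.image fun v => (M.leftPos v, M.rightPos v))
    (by simpa using fun v => leftPos_lt_rightPos hG v)
    (by simpa using fun v w => leftPos_lt_iff hG)
  have hl : ∀ v, M.leftPos v ∈ {a | ∃ p ∈ Finset.univ.image fun v => (M.leftPos v, M.rightPos v),
      a = p.1 ∨ a = p.2} := fun v => ⟨_, Finset.mem_image_of_mem _ (Finset.mem_univ v), .inl rfl⟩
  have hr : ∀ v, M.rightPos v ∈ {a | ∃ p ∈ Finset.univ.image fun v => (M.leftPos v, M.rightPos v),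
      a = p.1 ∨ a = p.2} := fun v => ⟨_, Finset.mem_image_of_mem _ (Finset.mem_univ v), .inr rfl⟩
  have hone : ∀ v, φ (M.leftPos v) + 1 = φ (M.rightPos v) := fun v =>
    (hunit _ (Finset.mem_image_of_mem _ (Finset.mem_univ v))).symm
  have key : ∀ u v, M.l u ≤ M.r v ↔ φ (M.leftPos u) < φ (M.leftPos v) + 1 ∨
      φ (M.leftPos u) = φ (M.leftPos v) + 1 ∧ ¬ M.LeftOpen u ∧ ¬ M.flip.LeftOpen v := by
    intro u v
    rw [hone, hφ.lt_iff_lt (hl u) (hr v), hφ.injOn.eq_iff (hl u) (hr v)]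
    refine ⟨leftPos_le_rightPos hG, fun h => ?_⟩
    by_contra! hc
    rcases rightPos_le_leftPos hG hc with h1 | ⟨h1, h2⟩ <;> rcases h with h | h
    · exact h.not_gt h1
    · exact h1.ne' h.1
    · exact h.ne h1.symm
    · tauto
  exact ⟨⟨fun v => φ (M.leftPos v), fun v => ¬ M.LeftOpen v, fun v => ¬ M.flip.LeftOpen v,
    fun u v huv => by rw [M.adj_iff u v huv, key, key]⟩⟩

end MixedUnitInterval

theorem theorem3p3 {V : Type*} [Finite V] (G : SimpleGraph V)
    (hG : MixedUnitInterval.TwinFree G) :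
    MixedUnitInterval.IsMixedUnitIntervalGraph G ↔
      MixedUnitInterval.IsIntervalGraph G ∧
        MixedUnitInterval.FamilyFree MixedUnitInterval.forbidden G := by
  refine ⟨fun h => ⟨h.isIntervalGraph, ?_⟩, fun h => ?_⟩
  · obtain ⟨R⟩ := MixedUnitInterval.isMixedUnitIntervalGraph_iff.1 h
    exact R.familyFree hG
  · obtain ⟨M⟩ := MixedUnitInterval.exists_cliqueModel hG h.1
    exact MixedUnitInterval.isMixedUnitIntervalGraph_iff.2 (M.nonempty_unitRep h.2)
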